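/- All graphs are finite, simple and undirected. A separation of $G$ is a pair $(G_1,G_2)$ of subgraphs with $V(G_1)\cup V(G_2)=V(G)$ and no edge of $G$ between $V(G_1)\setminus V(G_2)$ and $V(G_2)\setminus V(G_1)$; its order is $|V(G_1)\cap V(G_2)|$. $G$ is $(L,p)$-unbreakable if every separation of $G$ of order at most $p$ has $|V(G_1)|\le L$ or $|V(G_2)|\le L$. $\mathsf{DP}_k[(s_1,t_1),\dots,(s_k,t_k)]$ holds in $G$ if there are paths $P_i$ from $s_i$ to $t_i$ ($1\le i\le k$) such that, for $i\neq j$, no vertex of $P_i$ is an internal vertex of $P_j$. $\mathsf{FO}+\mathsf{DP}$ is first-order logic, over a relational signature with a binary symbol $E$ interpreted as the edge relation of a graph, extended by the atoms $\mathsf{DP}_j[(x_1,y_1),\dots,(x_j,y_j)]$, $j\ge 1$, evaluated in that graph. For $k,L\in\mathbb N$ let $\varphi_{k,L}(x_1,y_1,\dots,x_k,y_k)$ be the first-order formula in the language of graphs which says the following. Call $x_1,y_1,\dots,x_k,y_k$ the terminals, let $C_1,\dots,C_r$ be the classes of the finest partition of the terminals such that terminals at distance at most $L$ are in the same class, and give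 weight $k$ to each vertex that is a terminal and weight $1$ to each other vertex. There are, for every $i\le r$, vertex sets $S_i\subseteq D_i$ with $C_i\subseteq D_i$ and $|D_i|\le L$ such that no vertex of $D_i\setminus S_i$ has a neighbour outside $D_i$, the weight of $S_i$ being minimum among all pairs $(D_i',S_i')$ with these properties; and there is, for every terminal $z$, a walk $W_z$ of length at most $L$ which starts at $z$ and stays in the set $D_i$ of the class $C_i$ of $z$, such that (a) for every $j$, either $W_{x_j}$ and $W_{y_j}$ end in the same vertex, or each of them ends in the set $S_i$ of the class of its terminal; (b) for $j\ne l$, every common vertex of $W_{x_j}\cup W_{y_j}$ and $W_{x_l}\cup W_{y_l}$ lies in $\{x_j,y_j\}\cap\{x_l,y_l\}$. (All these sets and walks have bounded size and are named by existentially quantified vertices, so $\varphi_{k,L}$ is first-order and depends only on $k$ and $L$.) **Lemma.** Let $q\colon\mathbb N\to\mathbb N$ be any function (in particular, $q$ may be the function for which, by the theorem of Cygan et al., every graph has for every $k$ a strongly $(q(k),k)$-unbreakable tree decomposition of adhesion at most $q(k)$). Let $k\in\mathbb N$, $p=4k^3$, $L=q(p)$ and $t=\max\{6k^3,2kL\}$.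 1. For every $(L,p)$-unbreakable graph $G$ that contains $K_t$ as a minor and all $x_1,y_1,\dots,x_k,y_k\in V(G)$: $$G\models\mathsf{DP}_k[(x_1,y_1),\dots,(x_k,y_k)]\iff G\models\varphi_{k,L}(x_1,y_1,\dots,x_k,y_k).$$ 2. Consequently $\mathsf{FO}+\mathsf{DP}$ collapses to $\mathsf{FO}$ on such graphs: for every relational signature $\Sigma$ with a binary symbol $E$ and every $\mathsf{FO}+\mathsf{DP}$ formula $\psi(\bar z)$ over $\Sigma$ all of whose disjoint-paths atoms $\mathsf{DP}_j$ have $j\le k$, there is a first-order formula $\chi(\bar z)$ over $\Sigma$ such that for every finite $\Sigma$-structure $\mathbb A$ in which $E$ is the edge relation of an $(L,p)$-unbreakable graph containing $K_t$ as a minor, and every tuple $\bar a$ of elements, $\mathbb A\models\psi(\bar a)\iff\mathbb A\models\chi(\bar a)$. -/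

import Mathlib

open FirstOrder FirstOrder.Language

universe u v v' w

namespace DPLogic

/-! ## Graphs: separations, unbreakability, minors, disjoint paths -/

/-- `(G₁, G₂)` is a separation of `G`: the two subgraphs cover all vertices and there is no edge
of `G` between `V(G₁) \ V(G₂)` and `V(G₂) \ V(G₁)`. -/
structure IsSeparation {V : Type*} (G : SimpleGraph V) (G₁ G₂ : G.Subgraph) : Prop where
  union_eq : G₁.verts ∪ G₂.verts = Set.univ
  not_adj : ∀ u ∈ G₁.verts \ G₂.verts, ∀ v ∈ G₂.verts \ G₁.verts, ¬ G.Adj u v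

/-- The subgraph `H` is `(q, k)`-unbreakable in the (finite) graph `G`: for every separation
`(G₁, G₂)` of `G` of order `|V(G₁) ∩ V(G₂)| ≤ k`, one of the two sides contains at most `q`
vertices of `H`. -/
def IsUnbreakableIn {V : Type*} (G : SimpleGraph V) (H : G.Subgraph) (q k : ℕ) : Prop :=
  ∀ G₁ G₂ : G.Subgraph, IsSeparation G G₁ G₂ → (G₁.verts ∩ G₂.verts).ncard ≤ k →
    (G₁.verts ∩ H.verts).ncard ≤ q ∨ (G₂.verts ∩ H.verts).ncard ≤ q

/-- The graph `G` itself is `(q, k)`-unbreakable. -/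
def IsUnbreakable {V : Type*} (G : SimpleGraph V) (q k : ℕ) : Prop :=
  IsUnbreakableIn G ⊤ q k

/-- `H` is a minor of `G`: there are pairwise disjoint nonempty connected branch sets
`B w ⊆ V(G)`, one for every vertex `w` of `H`, such that every edge of `H` is
represented by an edge of `G` between the corresponding branch sets. -/
def IsMinor {W V : Type*} (H : SimpleGraph W) (G : SimpleGraph V) : Prop :=
  ∃ B : W → Set V,
    (∀ w, (G.induce (B w)).Connected) ∧
    (∀ w w', w ≠ w' → Disjoint (B w) (B w')) ∧
    (∀ w w', H.Adj w w' → ∃ u ∈ B w, ∃ v ∈ B w', G.Adj u v)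

/-- `v` is an internal vertex of the path `P`: it lies on `P` and is not an endpoint of `P`. -/
def IsInternal {V : Type*} {G : SimpleGraph V} {a b : V} (P : G.Path a b) (v : V) : Prop :=
  v ∈ P.1.support ∧ v ≠ a ∧ v ≠ b

/-- No vertex of one of the two paths is an internal vertex of the other one. -/
def InternallyDisjoint {V : Type*} {G : SimpleGraph V} {a b c d : V}
    (P : G.Path a b) (Q : G.Path c d) : Prop :=
  (∀ v ∈ P.1.support, ¬ IsInternal Q v) ∧ (∀ v ∈ Q.1.support, ¬ IsInternal P v)

/-- The disjoint-paths query `DP_k[(s₁,t₁),…,(s_k,t_k)]` holds in `G`. -/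
def DP {V : Type*} (G : SimpleGraph V) {k : ℕ} (s t : Fin k → V) : Prop :=
  ∃ P : (i : Fin k) → G.Path (s i) (t i), ∀ i j, i ≠ j → InternallyDisjoint (P i) (P j)

/-! ## Disjoint-paths logic -/

/-- The relation symbols of disjoint-paths logic: for every `k ≥ 1` the predicate `DP_k`
with `2k` arguments `x₁, y₁, …, x_k, y_k`. -/
inductive DPRel : ℕ → Type
  | dp (k : ℕ) (hk : 1 ≤ k) : DPRel (k * 2)

/-- The index `k` of the predicate `DP_k`. -/
def DPRel.index : {n : ℕ} → DPRel n → ℕ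
  | _, .dp k _ => k

/-- The language consisting of all disjoint-paths predicates. -/
def dpLang : Language := ⟨fun _ => Empty, DPRel⟩

/-- The interpretation of the disjoint-paths predicates in a graph. The arguments are ordered
`x₁, y₁, x₂, y₂, …`, as `finProdFinEquiv (i, b) = 2 * i + b`. -/
@[reducible]
def dpStructure {V : Type*} (G : SimpleGraph V) : dpLang.Structure V where
  funMap := fun f => f.elim
  RelMap := fun R xs =>
    match R, xs with
    | .dp _ _, xs =>
      DP G (fun i => xs (finProdFinEquiv (i, 0))) (fun i => xs (finProdFinEquiv (i, 1)))

/-- Formulas of `FO+DP` over the signature `Σ` with free variables in `α`: first-order formulas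
over `Σ` extended by the predicates `DP_k`, `k ≥ 1`. -/
abbrev FODPFormula (S : Language) (α : Type*) := (S.sum dpLang).Formula α

/-- Satisfaction of `FO+DP` formulas in a `Σ`-structure with underlying graph `G`. -/
def FODPRealize {S : Language} {V α : Type*} [S.Structure V] (G : SimpleGraph V)
    (ψ : FODPFormula S α) (a : α → V) : Prop :=
  letI := dpStructure G
  ψ.Realize a

/-- All disjoint-paths predicates `DP_j` that occur in the formula have index `j ≤ k`. -/
def DPIndexLE {S : Language} {α : Type*} (k : ℕ) :
    {n : ℕ} → (S.sum dpLang).BoundedFormula α n → Prop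
  | _, .falsum => True
  | _, .equal _ _ => True
  | _, .rel R _ => Sum.elim (fun _ => True) (fun R' : DPRel _ => R'.index ≤ k) R
  | _, .imp φ ψ => DPIndexLE k φ ∧ DPIndexLE k ψ
  | _, .all φ => DPIndexLE k φ

/-! ## The first-order formula expressing `DP_k`

All formulas below are first-order formulas in the language of graphs; `α` is the type of their
free variables. -/

section Formulas

variable {α : Type}

/-- The formula `a = b`. -/
def eqF (a b : α) : Language.graph.Formula α :=
  Term.equal (Term.var a) (Term.var b)

/-- The formula `E(a, b)`. -/
def adjF (a b : α) : Language.graph.Formula α :=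
  adj.formula₂ (Term.var a) (Term.var b)

/-- `a` is one of the vertices `v i` with `i ∈ σ`. -/
noncomputable def memF {n : ℕ} (a : α) (v : Fin n → α) (σ : Set (Fin n)) :
    Language.graph.Formula α :=
  Formula.iSup fun i : σ => eqF a (v i)

/-- Any two consecutive vertices of the sequence `v₀, …, v_n` are equal or adjacent; so the
sequence runs through a walk of length at most `n` from `v₀` to `v_n`. -/
noncomputable def walkF {n : ℕ} (v : Fin (n + 1) → α) : Language.graph.Formula α :=
  Formula.iInf fun i : Fin n => eqF (v i.castSucc) (v i.succ) ⊔ adjF (v i.castSucc) (v i.succ)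

/-- The distance between `a` and `b` is at most `n`. -/
noncomputable def distLEF (n : ℕ) (a b : α) : Language.graph.Formula α :=
  Formula.iExs (Fin (n + 1)) <|
    walkF (α := α ⊕ Fin (n + 1)) Sum.inr ⊓
      eqF (Sum.inl a) (Sum.inr 0) ⊓ eqF (Sum.inl b) (Sum.inr (Fin.last n))

/-- The index set of the terminals: `Sum.inl i` stands for `x_i` and `Sum.inr i` for `y_i`. -/
abbrev Term2 (k : ℕ) := Fin k ⊕ Fin k

/-- The clusters, if `δ` is the relation "at distance at most `L`" on the terminals: the classes of
the finest partition of the terminals such that terminals related by `δ` are in the same class. -/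
abbrev Cluster {k : ℕ} (δ : Term2 k → Term2 k → Prop) :=
  Quotient (Relation.EqvGen.setoid δ)

/-- The terminals in the cluster `c`. -/
def Cluster.terminals {k : ℕ} {δ : Term2 k → Term2 k → Prop} (c : Cluster δ) : Set (Term2 k) :=
  {a | Quotient.mk _ a = c}

/-- The pairs of terminals `x a` at distance at most `L` are exactly the pairs in `δ`. -/
noncomputable def distPatternF {k : ℕ} (L : ℕ) (δ : Term2 k → Term2 k → Prop) (x : Term2 k → α) :
    Language.graph.Formula α :=
  (Formula.iInf fun e : {e : Term2 k × Term2 k // δ e.1 e.2} => distLEF L (x e.1.1) (x e.1.2)) ⊓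
  (Formula.iInf fun e : {e : Term2 k × Term2 k // ¬ δ e.1 e.2} =>
    (distLEF L (x e.1.1) (x e.1.2)).not)

/-- For `D = {d₁, …, d_L}` (a nonempty set of at most `L` vertices; repetitions are allowed) and
`S = {d_l | l ∈ σ} ⊆ D`: the set `D` contains the terminals `x a`, `a ∈ C`, and
`(G[D], G - (D \ S))` is a separation of `G`, i.e. every neighbour `z` of a vertex in `D \ S`
belongs to `D`. -/
noncomputable def sepF {k L : ℕ} (x : Term2 k → α) (C : Set (Term2 k)) (d : Fin L → α)
    (σ : Set (Fin L)) : Language.graph.Formula α :=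
  (Formula.iInf fun a : C => memF (x a) d Set.univ) ⊓
  Formula.iAlls Unit (Formula.iInf fun l : Fin L =>
    (adjF (α := α ⊕ Unit) (Sum.inl (d l)) (Sum.inr ())).imp
      (memF (Sum.inl (d l)) (fun m => Sum.inl (d m)) σ ⊔
        memF (Sum.inr ()) (fun m => Sum.inl (d m)) Set.univ))

/-- The weight of `S = {d_l | l ∈ σ}` is at most `n`, where terminals have weight `k` and all other
vertices have weight `1`: there are `|τ₁|` vertices covering the terminals in `S` and
`|τ₀|` vertices covering the non-terminals in `S`, where `k |τ₁| + |τ₀| ≤ n`. -/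
noncomputable def weightLEF {k L : ℕ} (x : Term2 k → α) (d : Fin L → α) (σ : Set (Fin L)) (n : ℕ) :
    Language.graph.Formula α :=
  Formula.iSup fun τ : {τ : Set (Fin L) × Set (Fin L) // k * τ.1.ncard + τ.2.ncard ≤ n} =>
    Formula.iInf fun l : σ =>
      memF (d l) d τ.1.1 ⊔
        (memF (d l) d τ.1.2 ⊓ (Formula.iSup fun a : Term2 k => eqF (d l) (x a)).not)

/-- The pair `(D, S)` given by `d` and `σ` is a separation as in `sepF` for the terminals in `C`,
and the weight of `S` is minimum among all such pairs `(D', S')`. (All weights are at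
most `k * L`.) -/
noncomputable def minSepF {k L : ℕ} (x : Term2 k → α) (C : Set (Term2 k)) (d : Fin L → α)
    (σ : Set (Fin L)) : Language.graph.Formula α :=
  sepF x C d σ ⊓
  Formula.iAlls (Fin L) (Formula.iInf fun σ' : Set (Fin L) =>
    (sepF (α := α ⊕ Fin L) (fun a => Sum.inl (x a)) C Sum.inr σ').imp <|
      Formula.iInf fun n : Fin (k * L + 1) =>
        (weightLEF (α := α ⊕ Fin L) (fun a => Sum.inl (x a)) Sum.inr σ' n).imp
          (weightLEF (fun a => Sum.inl (x a)) (fun l => Sum.inl (d l)) σ n))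

/-- Bounded length connections inside the sets `D_c`, where `D_c` and `S_c ⊆ D_c` are given by
`d c` and `σ c` for every cluster `c`. For every terminal `a`, the walk `w a` of length at most `L`
starts at `x a` and stays inside the set `D_c` of the cluster `c` of `a`. For every
`i`, the walks of `x_i` and of `y_i` meet at their ends (so that `x_i` and `y_i` are connected inside
the sets `D_c`), or both end in the separators of their clusters. For `i ≠ j`, every common vertex
of the walks of the `i`-th and the `j`-th pair is in `{x_i, y_i} ∩ {x_j, y_j}`. -/
noncomputable def linkF {k L : ℕ} {δ : Term2 k → Term2 k → Prop} (x : Term2 k → α)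
    (d : Cluster δ → Fin L → α) (σ : Cluster δ → Set (Fin L))
    (w : Term2 k → Fin (L + 1) → α) : Language.graph.Formula α :=
  (Formula.iInf fun a : Term2 k =>
    walkF (w a) ⊓ eqF (x a) (w a 0) ⊓
      Formula.iInf fun l : Fin (L + 1) => memF (w a l) (d (Quotient.mk _ a)) Set.univ) ⊓
  (Formula.iInf fun i : Fin k =>
    eqF (w (.inl i) (Fin.last L)) (w (.inr i) (Fin.last L)) ⊔
      (memF (w (.inl i) (Fin.last L)) (d (Quotient.mk _ (.inl i))) (σ (Quotient.mk _ (.inl i))) ⊓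
        memF (w (.inr i) (Fin.last L)) (d (Quotient.mk _ (.inr i))) (σ (Quotient.mk _ (.inr i))))) ⊓
  (Formula.iInf fun e : {e : Fin k × Fin k // e.1 ≠ e.2} =>
    Formula.iInf fun a : {a : Term2 k // a = .inl e.1.1 ∨ a = .inr e.1.1} =>
    Formula.iInf fun b : {b : Term2 k // b = .inl e.1.2 ∨ b = .inr e.1.2} =>
    Formula.iInf fun l : Fin (L + 1) × Fin (L + 1) =>
      (eqF (w a l.1) (w b l.2)).imp
        ((eqF (w a l.1) (x (.inl e.1.1)) ⊔ eqF (w a l.1) (x (.inr e.1.1))) ⊓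
          (eqF (w a l.1) (x (.inl e.1.2)) ⊔ eqF (w a l.1) (x (.inr e.1.2)))))

end Formulas

/-- The first-order formula `φ(x₁, y₁, …, x_k, y_k)` expressing `DP_k`: guess the
pairs of terminals at distance at most `L`, which determines the clusters `C_c`; guess vertices
naming, for every cluster `c`, a set `D_c ⊇ C_c` and a separator `S_c ⊆ D_c` of minimum
weight; and guess connections of bounded length inside these sets. -/
noncomputable def dpFormula (k L : ℕ) : Language.graph.Formula (Term2 k) :=
  Formula.iSup fun δ : Term2 k → Term2 k → Prop =>
    distPatternF L δ id ⊓
    Formula.iSup fun σ : Cluster δ → Set (Fin L) =>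
      Formula.iExs ((Cluster δ × Fin L) ⊕ (Term2 k × Fin (L + 1))) <|
        (Formula.iInf fun c : Cluster δ =>
          minSepF Sum.inl c.terminals (fun l => Sum.inr (.inl (c, l))) (σ c)) ⊓
        linkF Sum.inl (fun c l => Sum.inr (.inl (c, l))) σ (fun a l => Sum.inr (.inr (a, l)))

/-- Satisfaction `G ⊨ φ(a)` of a first-order formula in the language of graphs. -/
def GraphRealize {V α : Type*} (G : SimpleGraph V) (φ : Language.graph.Formula α)
    (a : α → V) : Prop :=
  letI := G.structure
  φ.Realize a

end DPLogic

/-! The core is a linking argument in the style of Robertson and Seymour. Let `(D, S)` be a cut-off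
part around the terminals whose separator has minimum weight, terminals counting `k` times. Delete
`D \ S`, split every terminal in `S` into `k` copies, and make the resulting set `Z` of copies a
clique. If fewer than `|Z|` vertices separated `Z` from a branch set outside `D`, they would yield a
cheaper separator around the terminals; by unbreakability its terminal side has at most `L` vertices
(`IsCut.ncard_le`), against minimality. At least `2|Z|` branch sets avoid `D`, so
`exists_rooted_minor` provides disjoint connected sets rooted at the copies, any two joined by an
edge. Outside `D` every pairing of separator vertices can therefore be realised, and only the part
inside `D` has to be guessed (`DP.of_isCut`).

The formula guesses one part per cluster. A part of size at most `L` around all terminals falls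
apart into disjoint parts for the clusters, since a common vertex would put terminals of two
clusters at distance at most `L`. Weights then add up, so separators that are minimum for each
cluster have a union that is minimum overall (`DP.of_isLink`). Conversely, each path of a solution
is cut where it first meets the separator and shortened to a walk of length at most `L`
(`DP.exists_isLink`).

Both `Tough.exists_linkage` (Menger) and `exists_rooted_minor` go by induction: split along a
nontrivial tight set and glue; if there is none, contract an edge, which cannot destroy toughness;
if nothing can be contracted, Hall's theorem finishes.

For the collapse, an atom `DP_j` with `j ≤ k` is padded by trivial paths to `DP_k` and replaced by
the formula. -/

namespace DPLogic

/-! ## Connected sets, vertex boundaries and contractions -/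

section Sets

variable {V : Type*}

/-- The set `S` is nonempty and every proper nonempty subset of `S` is left by an edge of `G`
inside `S`. -/
def ConnOn (G : SimpleGraph V) (S : Set V) : Prop :=
  S.Nonempty ∧ ∀ T ⊆ S, T.Nonempty → (S \ T).Nonempty → ∃ a ∈ T, ∃ b ∈ S \ T, G.Adj a b

/-- The vertices outside `F` that have a neighbour in `F`. -/
def bdry (G : SimpleGraph V) (F : Set V) : Set V := {v | v ∉ F ∧ ∃ a ∈ F, G.Adj a v}

/-- Inside `U`, at least `|Z|` vertices are needed to separate `Z` from `F₀`. -/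
def Tough (G : SimpleGraph V) (U Z F₀ : Set V) : Prop :=
  ∀ F, F₀ ⊆ F → F ⊆ U → Disjoint F Z → Z.ncard ≤ (bdry G F).ncard

/-- The graph obtained by contracting `v` into `u`; the vertex `v` becomes isolated. -/
def contract (G : SimpleGraph V) (u v : V) : SimpleGraph V where
  Adj a b := a ≠ b ∧ a ≠ v ∧ b ≠ v ∧ (G.Adj a b ∨ (a = u ∧ G.Adj v b) ∨ (b = u ∧ G.Adj a v))
  symm := ⟨by
    rintro a b ⟨h1, h2, h3, h4⟩
    refine ⟨h1.symm, h3, h2, ?_⟩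
    rcases h4 with h | ⟨h, h'⟩ | ⟨h, h'⟩
    · exact Or.inl h.symm
    · exact Or.inr (Or.inr ⟨h, h'.symm⟩)
    · exact Or.inr (Or.inl ⟨h, h'.symm⟩)⟩
  loopless := ⟨fun a h => h.1 rfl⟩

theorem ConnOn.singleton (G : SimpleGraph V) (a : V) : ConnOn G {a} := by
  refine ⟨⟨a, rfl⟩, fun T hT ⟨b, hb⟩ ⟨c, hc⟩ => ?_⟩
  have h1 : b = a := hT hb
  have h2 : c = a := hc.1
  exact absurd (h2 ▸ h1 ▸ hb) hc.2

theorem ConnOn.mono {G H : SimpleGraph V} {S : Set V} (h : ConnOn G S)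
    (hGH : ∀ a ∈ S, ∀ b ∈ S, G.Adj a b → H.Adj a b) : ConnOn H S := by
  refine ⟨h.1, fun T hT h1 h2 => ?_⟩
  obtain ⟨a, ha, b, hb, hab⟩ := h.2 T hT h1 h2
  exact ⟨a, ha, b, hb, hGH a (hT ha) b hb.1 hab⟩

/-- Two connected sets joined by an edge or a common vertex have a connected union. -/
theorem ConnOn.union {G : SimpleGraph V} {S T : Set V} (hS : ConnOn G S) (hT : ConnOn G T)
    {a b : V} (ha : a ∈ S) (hb : b ∈ T) (hab : a = b ∨ G.Adj a b) : ConnOn G (S ∪ T) := by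
  refine ⟨hS.1.mono Set.subset_union_left, fun R hR hR1 hR2 => ?_⟩
  by_cases h1 : (R ∩ S).Nonempty ∧ (S \ R).Nonempty
  · obtain ⟨x, hx, y, hy, hxy⟩ := hS.2 (R ∩ S) Set.inter_subset_right h1.1
      (by rw [Set.inter_comm, Set.sdiff_self_inter]; exact h1.2)
    exact ⟨x, hx.1, y, ⟨Or.inl hy.1, fun h => hy.2 ⟨h, hy.1⟩⟩, hxy⟩
  by_cases h2 : (R ∩ T).Nonempty ∧ (T \ R).Nonempty
  · obtain ⟨x, hx, y, hy, hxy⟩ := hT.2 (R ∩ T) Set.inter_subset_right h2.1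
      (by rw [Set.inter_comm, Set.sdiff_self_inter]; exact h2.2)
    exact ⟨x, hx.1, y, ⟨Or.inr hy.1, fun h => hy.2 ⟨h, hy.1⟩⟩, hxy⟩
  have key : ∀ {P : Set V}, ¬ ((R ∩ P).Nonempty ∧ (P \ R).Nonempty) →
      ∀ x ∈ P, ∀ y ∈ P, x ∈ R → y ∈ R := by
    intro P hP x hx y hy hxR
    by_contra hyR
    exact hP ⟨⟨x, hxR, hx⟩, ⟨y, hy, hyR⟩⟩
  have k1 := key h1
  have k2 := key h2
  obtain ⟨r, hr⟩ := hR1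
  obtain ⟨s, hs, hsR⟩ := hR2
  have hrU := hR hr
  by_cases haR : a ∈ R
  · by_cases hbR : b ∈ R
    · rcases hs with hs | hs
      · exact absurd (k1 a ha s hs haR) hsR
      · exact absurd (k2 b hb s hs hbR) hsR
    · rcases hab with h | h
      · exact absurd (h ▸ haR) hbR
      · exact ⟨a, haR, b, ⟨Or.inr hb, hbR⟩, h⟩
  · by_cases hbR : b ∈ R
    · rcases hab with h | h
      · exact absurd (h ▸ hbR) haR
      · exact ⟨b, hbR, a, ⟨Or.inl ha, haR⟩, h.symm⟩
    · rcases hrU with h | h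
      · exact absurd (k1 r h a ha hr) haR
      · exact absurd (k2 r h b hb hr) hbR

/-- A connected set containing a vertex of `R` stays inside `R` if no edge leaves `R`. -/
theorem ConnOn.subset_of_closed {G : SimpleGraph V} {S R : Set V} (hS : ConnOn G S) {x : V}
    (hx : x ∈ S) (hxR : x ∈ R) (hR : ∀ a b, a ∈ R → G.Adj a b → b ∈ S → b ∈ R) : S ⊆ R := by
  intro y hy
  by_contra hyR
  obtain ⟨a, ha, b, hb, hab⟩ := hS.2 (S ∩ R) Set.inter_subset_left ⟨x, hx, hxR⟩
    ⟨y, hy, fun h => hyR h.2⟩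
  exact hb.2 ⟨hb.1, hR a b ha.2 hab hb.1⟩

/-- A side containing `u` is enlarged by `v`, whose edges become edges of `u`. For any other side,
an edge leaving it towards `v` is redirected to `u`, which lies across. -/
theorem ConnOn.contract {G : SimpleGraph V} {u v : V} (huv : u ≠ v) {S : Set V} (hS : ConnOn G S)
    (h : v ∈ S → u ∈ S) : ConnOn (contract G u v) (S \ {v}) := by
  constructor
  · by_cases hv : v ∈ S
    · exact ⟨u, h hv, huv⟩
    · obtain ⟨x, hx⟩ := hS.1
      exact ⟨x, hx, fun hxv => hv (hxv ▸ hx)⟩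
  intro T hT hT1 ⟨y, ⟨hyS, hyv⟩, hyT⟩
  have hyv : y ≠ v := hyv
  have hTv : v ∉ T := fun hv => (hT hv).2 rfl
  by_cases hc : u ∈ T ∧ v ∈ S
  · obtain ⟨a, ha, b, hb, hab⟩ := hS.2 (insert v T)
      (Set.insert_subset hc.2 (hT.trans Set.sdiff_subset)) ⟨v, Or.inl rfl⟩
      ⟨y, hyS, fun h => h.elim hyv hyT⟩
    have hbv : b ≠ v := fun e => hb.2 (Or.inl e)
    have hbT : b ∉ T := fun e => hb.2 (Or.inr e)
    rcases ha with rfl | ha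
    · exact ⟨u, hc.1, b, ⟨⟨hb.1, hbv⟩, hbT⟩, fun e => hbT (e ▸ hc.1), huv, hbv,
        Or.inr (Or.inl ⟨rfl, hab⟩)⟩
    · exact ⟨a, ha, b, ⟨⟨hb.1, hbv⟩, hbT⟩, hab.ne, (hT ha).2, hbv, Or.inl hab⟩
  · obtain ⟨a, ha, b, hb, hab⟩ := hS.2 T (hT.trans Set.sdiff_subset) hT1 ⟨y, hyS, hyT⟩
    by_cases hbv : b = v
    · subst hbv
      have hu : u ∉ T := fun hu => hc ⟨hu, hb.1⟩
      exact ⟨a, ha, u, ⟨⟨h hb.1, huv⟩, hu⟩, fun e => hu (e ▸ ha), (hT ha).2, huv,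
        Or.inr (Or.inr ⟨rfl, hab⟩)⟩
    · exact ⟨a, ha, b, ⟨⟨hb.1, hbv⟩, hb.2⟩, hab.ne, (hT ha).2, hbv, Or.inl hab⟩

/-- Undo the contraction of `v` into `u` in a set of vertices. -/
def expand (u v : V) (C : Set V) : Set V := {w | w ∈ C ∨ (w = v ∧ u ∈ C)}

/-- A bipartition separating `u` from `v` is crossed by the edge `uv`. Otherwise both lie on one
side, and a crossing edge of the contraction lifts to an edge at `u` or at `v`. -/
theorem ConnOn.expand {G : SimpleGraph V} {u v : V} (huv : G.Adj u v) {C : Set V}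
    (hC : ConnOn (DPLogic.contract G u v) C) : ConnOn G (expand u v C) := by
  refine ⟨hC.1.mono fun _ h => Or.inl h, fun T hT hT1 ⟨y, hyC, hyT⟩ => ?_⟩
  by_cases hu : u ∈ C
  · by_cases huT : u ∈ T <;> by_cases hvT : v ∈ T
    · have hy : y ∈ C := hyC.elim id fun h => absurd (h.1 ▸ hvT) hyT
      obtain ⟨a, ha, b, hb, hab⟩ := hC.2 (T ∩ C) Set.inter_subset_right ⟨u, huT, hu⟩
        ⟨y, hy, fun h => hyT h.1⟩
      have hbT : b ∉ T := fun h => hb.2 ⟨h, hb.1⟩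
      rcases hab.2.2.2 with h | ⟨-, h⟩ | ⟨h, -⟩
      · exact ⟨a, ha.1, b, ⟨Or.inl hb.1, hbT⟩, h⟩
      · exact ⟨v, hvT, b, ⟨Or.inl hb.1, hbT⟩, h⟩
      · exact absurd (h ▸ huT) hbT
    · exact ⟨u, huT, v, ⟨Or.inr ⟨rfl, hu⟩, hvT⟩, huv⟩
    · exact ⟨v, hvT, u, ⟨Or.inl hu, huT⟩, huv.symm⟩
    · have hTC : T ⊆ C := fun x hx => (hT hx).elim id fun h => absurd (h.1 ▸ hx) hvT
      obtain ⟨a, ha, b, hb, hab⟩ := hC.2 T hTC hT1 ⟨u, hu, huT⟩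
      rcases hab.2.2.2 with h | ⟨h, -⟩ | ⟨-, h⟩
      · exact ⟨a, ha, b, ⟨Or.inl hb.1, hb.2⟩, h⟩
      · exact absurd (h ▸ ha) huT
      · exact ⟨a, ha, v, ⟨Or.inr ⟨rfl, hu⟩, hvT⟩, h⟩
  · have hCe : ∀ x ∈ DPLogic.expand u v C, x ∈ C := fun x hx => hx.elim id fun h => absurd h.2 hu
    obtain ⟨a, ha, b, hb, hab⟩ := hC.2 T (fun x hx => hCe x (hT hx)) hT1 ⟨y, hCe y hyC, hyT⟩
    rcases hab.2.2.2 with h | ⟨h, -⟩ | ⟨h, -⟩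
    · exact ⟨a, ha, b, ⟨Or.inl hb.1, hb.2⟩, h⟩
    · exact absurd (h ▸ hCe a (hT ha)) hu
    · exact absurd (h ▸ hb.1) hu

theorem expand_disjoint {u v : V} {C D : Set V} (hC : v ∉ C) (hD : v ∉ D) (h : Disjoint C D) :
    Disjoint (expand u v C) (expand u v D) := by
  rw [Set.disjoint_left] at h ⊢
  rintro w (hw | ⟨rfl, hw⟩) (hw' | ⟨hw', hw''⟩)
  · exact h hw hw'
  · exact hC (hw' ▸ hw)
  · exact hD hw'
  · exact h hw hw''

/-- Contracting `v` into `u` preserves toughness unless `v` lies on the boundary of a tight set. -/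
theorem Tough.contract [Finite V] {G : SimpleGraph V} {u v : V} (huv : u ≠ v) {U Z F₀ : Set V}
    (h : Tough G U Z F₀) (hvU : v ∈ U) (hvZ : v ∉ Z) (hF₀ : v ∈ F₀ → u ∈ F₀)
    (htight : ∀ F, F₀ ⊆ F → F ⊆ U → Disjoint F Z → (bdry G F).ncard = Z.ncard → v ∉ bdry G F) :
    Tough (contract G u v) (U \ {v}) Z (F₀ \ {v}) := by
  intro F hF hFU hFZ
  have hvF : v ∉ F := fun hv => (hFU hv).2 rfl
  by_cases huF : u ∈ F
  -- With `u` in `F`, uncontracting puts `v` into `F` as well, and the boundary does not grow.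
  · refine (h (insert v F) ?_ (Set.insert_subset hvU (hFU.trans Set.sdiff_subset)) ?_).trans
      (Set.ncard_le_ncard ?_ (Set.toFinite _))
    · intro x hx
      by_cases hxv : x = v
      · exact Or.inl hxv
      · exact Or.inr (hF ⟨hx, hxv⟩)
    · exact Set.disjoint_insert_left.2 ⟨hvZ, hFZ⟩
    · rintro w ⟨hw, a, ha, haw⟩
      have hwv : w ≠ v := fun e => hw (Or.inl e)
      have hwF : w ∉ F := fun e => hw (Or.inr e)
      rcases ha with rfl | ha
      · exact ⟨hwF, u, huF, fun e => hwF (e ▸ huF), huv, hwv, Or.inr (Or.inl ⟨rfl, haw⟩)⟩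
      · exact ⟨hwF, a, ha, haw.ne, fun e => hvF (e ▸ ha), hwv, Or.inl haw⟩
  -- With `u` outside `F`, the set `F` itself is tested in `G`. The contraction can lose only `v`
  -- from its boundary, which hurts only if `F` is tight.
  · have hF₀F : F₀ ⊆ F := by
      intro x hx
      refine hF ⟨hx, fun hxv => ?_⟩
      exact huF (hF ⟨hF₀ (hxv ▸ hx), huv⟩)
    have hFU' := hFU.trans Set.sdiff_subset
    have h1 := h F hF₀F hFU' hFZ
    have hsub : bdry G F \ {v} ⊆ bdry (DPLogic.contract G u v) F := by
      rintro w ⟨⟨hw, a, ha, haw⟩, hwv⟩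
      exact ⟨hw, a, ha, haw.ne, fun e => hvF (e ▸ ha), hwv, Or.inl haw⟩
    have h2 := Set.ncard_le_ncard hsub (Set.toFinite _)
    by_cases hvb : v ∈ bdry G F
    · have h3 : (bdry G F).ncard ≠ Z.ncard := fun e => htight F hF₀F hFU' hFZ e hvb
      have h4 := Set.ncard_sdiff_singleton_add_one hvb (Set.toFinite _)
      omega
    · rw [Set.sdiff_singleton_eq_self hvb] at h2
      omega

end Sets

/-! ## Menger's theorem in terms of disjoint connected sets -/

section Menger

variable {V : Type*}

theorem Tough.mono {G : SimpleGraph V} {U Z F F' : Set V} (h : Tough G U Z F) (hF : F ⊆ F') :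
    Tough G U Z F' := fun F₁ h1 => h F₁ (hF.trans h1)

theorem bdry_subset {G : SimpleGraph V} {U : Set V} (hU : ∀ a b, G.Adj a b → a ∈ U) (F : Set V) :
    bdry G F ⊆ U := fun _ ⟨_, _, _, h⟩ => hU _ _ h.symm

/-- The subgraph induced by `R`, with the vertices of `K` made pairwise adjacent. -/
def torso (G : SimpleGraph V) (R K : Set V) : SimpleGraph V where
  Adj a b := a ≠ b ∧ a ∈ R ∧ b ∈ R ∧ (G.Adj a b ∨ (a ∈ K ∧ b ∈ K))
  symm := ⟨fun _ _ ⟨h1, h2, h3, h4⟩ =>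
    ⟨h1.symm, h3, h2, h4.elim (fun h => Or.inl h.symm) fun h => Or.inr h.symm⟩⟩
  loopless := ⟨fun _ h => h.1 rfl⟩

theorem bdry_subset_bdry_torso {G : SimpleGraph V} {F F' : Set V} (hF : F' ⊆ F) (K : Set V) :
    bdry G F' ⊆ bdry (torso G (F ∪ bdry G F) K) F' := by
  rintro w ⟨hw, a, ha, haw⟩
  refine ⟨hw, a, ha, haw.ne, Or.inl (hF ha), ?_, Or.inl haw⟩
  by_cases hwF : w ∈ F
  · exact Or.inl hwF
  · exact Or.inr ⟨hwF, a, hF ha, haw⟩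

/-- A set avoiding `∂F` inside the torso lies in `F`, and its boundary in `G` is part of its
boundary in the torso. As `F` is tight, `|Z|` and `|∂F|` agree. -/
theorem Tough.torso [Finite V] {G : SimpleGraph V} {U Z F F₀ : Set V} (h : Tough G U Z F₀)
    (hFU : F ⊆ U) (hFZ : Disjoint F Z) (hcard : (bdry G F).ncard = Z.ncard) :
    Tough (torso G (F ∪ bdry G F) (bdry G F)) (F ∪ bdry G F) (bdry G F) F₀ := by
  intro F' hF₀ hF' hd
  have hF'F : F' ⊆ F := fun x hx => (hF' hx).elim id fun hb => absurd hb (Set.disjoint_left.1 hd hx)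
  rw [hcard]
  exact (h F' hF₀ (hF'F.trans hFU) (hFZ.mono_left hF'F)).trans
    (Set.ncard_le_ncard (bdry_subset_bdry_torso hF'F _) (Set.toFinite _))

/-- A connected set of the torso on `F ∪ ∂F` meeting `∂F` in a single vertex is connected in
the original graph and stays inside `F ∪ ∂F`. -/
theorem ConnOn.of_torso {G : SimpleGraph V} {R K C : Set V} {x : V} (hC : ConnOn (torso G R K) C)
    (hx : x ∈ C) (hxR : x ∈ R) (hK : ∀ y ∈ C, y ∈ K → y = x) : ConnOn G C ∧ C ⊆ R := by
  refine ⟨hC.mono fun a ha b hb hab => ?_, hC.subset_of_closed hx hxR fun a b _ hab _ => hab.2.2.1⟩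
  rcases hab.2.2.2 with h | h
  · exact h
  · exact absurd ((hK a ha h.1).trans (hK b hb h.2).symm) hab.1

/-- Disjoint sets that each meet `X`, as many as `X` has elements, use up all of `X`; so each meets
it exactly once. -/
theorem exists_transversal [Finite V] {Z X : Set V} {C : V → Set V} (hcard : X.ncard = Z.ncard)
    (hmeet : ∀ z ∈ Z, (C z ∩ X).Nonempty)
    (hdisj : ∀ z ∈ Z, ∀ z' ∈ Z, z ≠ z' → Disjoint (C z) (C z')) :
    ∃ f : V → V, (∀ z ∈ Z, f z ∈ X ∧ C z ∩ X = {f z}) ∧ Set.InjOn f Z := by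
  classical
  choose! f hf using hmeet
  have hinj : Set.InjOn f Z := by
    intro z hz z' hz' h
    by_contra hne
    exact Set.disjoint_left.1 (hdisj z hz z' hz' hne) (hf z hz).1 (h ▸ (hf z' hz').1)
  have himg : f '' Z = X := by
    refine Set.eq_of_subset_of_ncard_le ?_ ?_ (Set.toFinite _)
    · rintro _ ⟨z, hz, rfl⟩
      exact (hf z hz).2
    · rw [hinj.ncard_image, hcard]
  refine ⟨f, fun z hz => ⟨(hf z hz).2, ?_⟩, hinj⟩
  refine Set.Subset.antisymm ?_ (Set.singleton_subset_iff.2 (hf z hz))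
  rintro y ⟨hyC, hyX⟩
  rw [← himg] at hyX
  obtain ⟨z', hz', rfl⟩ := hyX
  by_contra hne
  have : z ≠ z' := fun e => hne (by rw [e]; rfl)
  exact Set.disjoint_left.1 (hdisj z hz z' hz' this) hyC (hf z' hz').1

/-- Gluing two linkages along the boundary of `F`. -/
theorem glue_disjoint {X F Z : Set V} {C₁ C₂ : V → Set V} {f : V → V}
    (hf : ∀ z ∈ Z, f z ∈ X ∧ C₁ z ∩ X = {f z}) (hinj : Set.InjOn f Z)
    (h₁F : ∀ z ∈ Z, Disjoint (C₁ z) F)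
    (h₁ : ∀ z ∈ Z, ∀ z' ∈ Z, z ≠ z' → Disjoint (C₁ z) (C₁ z'))
    (h₂R : ∀ x ∈ X, C₂ x ⊆ F ∪ X) (h₂X : ∀ x ∈ X, ∀ y ∈ C₂ x, y ∈ X → y = x)
    (h₂ : ∀ x ∈ X, ∀ x' ∈ X, x ≠ x' → Disjoint (C₂ x) (C₂ x')) :
    ∀ z ∈ Z, ∀ z' ∈ Z, z ≠ z' → Disjoint (C₁ z ∪ C₂ (f z)) (C₁ z' ∪ C₂ (f z')) := by
  have key : ∀ z ∈ Z, ∀ z' ∈ Z, z ≠ z' → Disjoint (C₁ z) (C₂ (f z')) := by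
    intro z hz z' hz' hne
    rw [Set.disjoint_left]
    intro y hy hy'
    rcases h₂R _ (hf z' hz').1 hy' with h | h
    · exact Set.disjoint_left.1 (h₁F z hz) hy h
    · have e1 : y = f z' := h₂X _ (hf z' hz').1 y hy' h
      have e2 : y ∈ C₁ z ∩ X := ⟨hy, h⟩
      rw [(hf z hz).2] at e2
      exact hne (hinj hz hz' ((show y = f z from e2).symm.trans e1))
  intro z hz z' hz' hne
  rw [Set.disjoint_union_left, Set.disjoint_union_right, Set.disjoint_union_right]
  exact ⟨⟨h₁ z hz z' hz' hne, key z hz z' hz' hne⟩, (key z' hz' z hz hne.symm).symm,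
    h₂ _ (hf z hz).1 _ (hf z' hz').1 fun e => hne (hinj hz hz' e)⟩

/-- Hall's theorem for subsets of a finite type. -/
theorem exists_matching [Finite V] {A B : Set V} (r : V → V → Prop)
    (h : ∀ Y ⊆ A, Y.ncard ≤ {b | b ∈ B ∧ ∃ a ∈ Y, r a b}.ncard) :
    ∃ m : V → V, (∀ a ∈ A, m a ∈ B ∧ r a (m a)) ∧ Set.InjOn m A := by
  classical
  have := Fintype.ofFinite V
  let t : A → Finset V := fun a => Finset.univ.filter fun b => b ∈ B ∧ r a b
  have hall : ∀ s : Finset A, s.card ≤ (s.biUnion t).card := by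
    intro s
    have h1 := h (Subtype.val '' (s : Set A)) (by rintro _ ⟨a, -, rfl⟩; exact a.2)
    rw [Set.ncard_image_of_injective _ Subtype.val_injective, Set.ncard_coe_finset] at h1
    refine h1.trans (le_of_eq ?_)
    rw [← Set.ncard_coe_finset]
    congr 1
    ext b
    simp [t]
  obtain ⟨f, hf, hft⟩ := (Finset.all_card_le_biUnion_card_iff_exists_injective t).1 hall
  refine ⟨fun a => if h : a ∈ A then f ⟨a, h⟩ else a, fun a ha => ?_, fun a ha b hb hab => ?_⟩
  · have := hft ⟨a, ha⟩
    simp only [t, Finset.mem_filter] at this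
    simpa [ha] using this.2
  · simp only [ha, hb, dif_pos] at hab
    exact congrArg Subtype.val (hf hab)

/-- Menger's theorem: if at least `|Z|` vertices are needed to separate `Z` from `F₀`, then there
are disjoint connected sets joining the vertices of `Z` to the boundary of `F₀`. -/
theorem Tough.exists_linkage [Finite V] (G : SimpleGraph V) (U Z F₀ : Set V)
    (hU : ∀ a b, G.Adj a b → a ∈ U) (hZU : Z ⊆ U) (hFU : F₀ ⊆ U) (hFZ : Disjoint F₀ Z)
    (h : Tough G U Z F₀) :
    ∃ C : V → Set V, (∀ z ∈ Z, z ∈ C z ∧ ConnOn G (C z) ∧ Disjoint (C z) F₀ ∧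
      (C z ∩ bdry G F₀).Nonempty) ∧
      ∀ z ∈ Z, ∀ z' ∈ Z, z ≠ z' → Disjoint (C z) (C z') := by
  induction hn : (U \ F₀).ncard using Nat.strong_induction_on generalizing G U Z F₀ with
  | _ n ih =>
  subst hn
  -- A tight set splits the problem: link `Z` to `∂F₁`, then link `∂F₁` to `∂F₀` inside the torso.
  -- The condition `F₁ ≠ F₀` makes the first problem smaller, and `∂F₁ ≠ Z` the second.
  by_cases hi : ∃ F₁, F₀ ⊆ F₁ ∧ F₁ ≠ F₀ ∧ F₁ ⊆ U ∧ Disjoint F₁ Z ∧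
      (bdry G F₁).ncard = Z.ncard ∧ bdry G F₁ ≠ Z
  · obtain ⟨F₁, hF, hne, hF₁U, hF₁Z, hcard, hbne⟩ := hi
    obtain ⟨C₁, hC₁, hd₁⟩ := ih _ (Set.ncard_lt_ncard (by
      refine ⟨Set.sdiff_subset_sdiff_right hF, fun hsub => hne ?_⟩
      refine Set.Subset.antisymm (fun x hx => ?_) hF
      by_contra hx0
      exact (hsub ⟨hF₁U hx, hx0⟩).2 hx) (Set.toFinite _)) G U Z F₁ hU hZU hF₁U hF₁Z (h.mono hF) rfl
    have hbU := bdry_subset hU F₁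
    obtain ⟨z, hz, hzb⟩ : ∃ z ∈ Z, z ∉ bdry G F₁ := by
      by_contra hcon
      push Not at hcon
      exact hbne (Set.eq_of_subset_of_ncard_le hcon hcard.le (Set.toFinite _)).symm
    have hzF : z ∉ F₁ := fun hh => Set.disjoint_left.1 hF₁Z hh hz
    obtain ⟨C₂, hC₂, hd₂⟩ := ih _ (Set.ncard_lt_ncard (by
      refine ⟨Set.sdiff_subset_sdiff_left (Set.union_subset hF₁U hbU), fun hsub => ?_⟩
      exact (hsub ⟨hZU hz, fun hh => hzF (hF hh)⟩).1.elim hzF hzb) (Set.toFinite _))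
      (DPLogic.torso G (F₁ ∪ bdry G F₁) (bdry G F₁)) (F₁ ∪ bdry G F₁) (bdry G F₁) F₀
      (fun a b hab => hab.2.1) Set.subset_union_right (hF.trans Set.subset_union_left)
      (Set.disjoint_left.2 fun x hx hxb => hxb.1 (hF hx)) (h.torso hF₁U hF₁Z hcard) rfl
    obtain ⟨f, hf, hinj⟩ := exists_transversal hcard (fun z hz => (hC₁ z hz).2.2.2) hd₁
    have h₂X : ∀ x ∈ bdry G F₁, ∀ y ∈ C₂ x, y ∈ bdry G F₁ → y = x := by
      intro x hx y hy hyb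
      by_contra hne
      exact Set.disjoint_left.1 (hd₂ x hx y hyb (Ne.symm hne)) hy (hC₂ y hyb).1
    have hC₂' : ∀ x ∈ bdry G F₁, ConnOn G (C₂ x) ∧ C₂ x ⊆ F₁ ∪ bdry G F₁ := fun x hx =>
      (hC₂ x hx).2.1.of_torso (hC₂ x hx).1 (Or.inr hx) (h₂X x hx)
    refine ⟨fun z => C₁ z ∪ C₂ (f z), fun z hz => ?_, glue_disjoint hf hinj
      (fun z hz => (hC₁ z hz).2.2.1) hd₁ (fun x hx => (hC₂' x hx).2) h₂X hd₂⟩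
    obtain ⟨a1, a2, a3, a4⟩ := hC₁ z hz
    obtain ⟨b1, b2⟩ := hf z hz
    have hfz : f z ∈ C₁ z := (b2.symm.subset rfl).1
    refine ⟨Or.inl a1, a2.union (hC₂' _ b1).1 hfz (hC₂ _ b1).1 (Or.inl rfl), ?_, ?_⟩
    · exact Set.disjoint_union_left.2 ⟨a3.mono_right hF, (hC₂ _ b1).2.2.1⟩
    · obtain ⟨y, hy, hyb⟩ := (hC₂ _ b1).2.2.2
      refine ⟨y, Or.inr hy, hyb.1, ?_⟩
      obtain ⟨-, a, ha, hay⟩ := hyb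
      refine ⟨a, ha, ?_⟩
      rcases hay.2.2.2 with h' | h'
      · exact h'
      · exact absurd (hF ha) h'.1.1
  by_cases hii : ∃ u v, G.Adj u v ∧ u ∉ F₀ ∧ v ∉ F₀ ∧ v ∉ bdry G F₀ ∧ v ∉ Z
  · obtain ⟨u, v, huv, hu, hv, hvb, hvZ⟩ := hii
    have hvU : v ∈ U := hU v u huv.symm
    have huU : u ∈ U := hU u v huv
    -- A tight set is now either `F₀` or has boundary `Z`, and `v` was chosen outside both
    -- boundaries.
    have ht : Tough (DPLogic.contract G u v) (U \ {v}) Z F₀ := by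
      have := h.contract huv.ne hvU hvZ (fun hh => absurd hh hv) (by
        intro F hF hFU hFZ hcard hvF
        by_cases he : F = F₀
        · exact hvb (he ▸ hvF)
        · exact hi ⟨F, hF, he, hFU, hFZ, hcard, fun e => hvZ (e ▸ hvF)⟩)
      rwa [Set.sdiff_singleton_eq_self hv] at this
    have hU' : ∀ a b, (DPLogic.contract G u v).Adj a b → a ∈ U \ {v} := by
      rintro a b ⟨h1, h2, h3, h4⟩
      refine ⟨?_, h2⟩
      rcases h4 with h4 | ⟨rfl, h4⟩ | ⟨-, h4⟩
      exacts [hU _ _ h4, huU, hU _ _ h4]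
    have hZU' : Z ⊆ U \ {v} := fun z hz => ⟨hZU hz, fun e => hvZ (e ▸ hz)⟩
    obtain ⟨C, hC, hd⟩ := ih _ (Set.ncard_lt_ncard (by
      refine ⟨Set.sdiff_subset_sdiff_left Set.sdiff_subset, fun hsub => ?_⟩
      exact (hsub ⟨hvU, hv⟩).1.2 rfl) (Set.toFinite _)) (DPLogic.contract G u v) (U \ {v}) Z F₀
      hU' hZU' (fun x hx => ⟨hFU hx, fun e => hv (e ▸ hx)⟩) hFZ ht rfl
    have hvC : ∀ z ∈ Z, v ∉ C z := fun z hz hvz =>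
      ((hC z hz).2.1.subset_of_closed (hC z hz).1 (hZU' hz)
        (fun a b _ hab _ => hU' b a hab.symm) hvz).2 rfl
    refine ⟨fun z => expand u v (C z), fun z hz => ?_, fun z hz z' hz' hne =>
      expand_disjoint (hvC z hz) (hvC z' hz') (hd z hz z' hz' hne)⟩
    obtain ⟨a1, a2, a3, y, hy, hyb⟩ := hC z hz
    refine ⟨Or.inl a1, a2.expand huv, ?_, y, Or.inl hy, hyb.1, ?_⟩
    · rw [Set.disjoint_left]
      rintro w (hw | ⟨rfl, -⟩)
      · exact Set.disjoint_left.1 a3 hw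
      · exact hv
    · obtain ⟨hyF, a, ha, h1, h2, h3, h4⟩ := hyb
      rcases h4 with h4 | ⟨rfl, h4⟩ | ⟨rfl, h4⟩
      · exact ⟨a, ha, h4⟩
      · exact absurd ha hu
      · exact absurd ⟨hv, a, ha, h4⟩ hvb
  -- Outside `F₀`, every edge now has both ends in `∂F₀ ∪ Z`, so one edge per vertex of `Z \ ∂F₀`
  -- has to suffice: a matching into `∂F₀ \ Z`.
  · push Not at hii
    obtain ⟨m, hm, hminj⟩ := exists_matching (A := Z \ bdry G F₀) (B := bdry G F₀ \ Z) G.Adj (by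
      intro Y hY
      set N := {b | b ∈ bdry G F₀ \ Z ∧ ∃ a ∈ Y, G.Adj a b} with hN
      have hNX : N ⊆ bdry G F₀ \ Z := fun b hb => hb.1
      -- Hall's condition comes from adding to `F₀` all candidates not adjacent to `Y`: the boundary
      -- of the result lies in `N ∪ (Z \ Y)`.
      have h1 := h (F₀ ∪ ((bdry G F₀ \ Z) \ N)) Set.subset_union_left
        (Set.union_subset hFU fun x hx => bdry_subset hU _ hx.1.1)
        (Set.disjoint_union_left.2 ⟨hFZ, Set.disjoint_left.2 fun x hx => hx.1.2⟩)
      have hsub : bdry G (F₀ ∪ ((bdry G F₀ \ Z) \ N)) ⊆ N ∪ (Z \ Y) := by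
        rintro w ⟨hw, a, ha, haw⟩
        have hwF : w ∉ F₀ := fun e => hw (Or.inl e)
        have hX : w ∈ bdry G F₀ → w ∈ N ∪ Z \ Y := by
          intro hwb
          by_cases hwZ : w ∈ Z
          · exact Or.inr ⟨hwZ, fun e => (hY e).2 hwb⟩
          · by_contra hcon
            exact hw (Or.inr ⟨⟨hwb, hwZ⟩, fun e => hcon (Or.inl e)⟩)
        rcases ha with ha | ha
        · exact hX ⟨hwF, a, ha, haw⟩
        · by_cases hwb : w ∈ bdry G F₀
          · exact hX hwb
          · have hwZ := hii a w haw ha.1.1.1 hwF hwb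
            exact Or.inr ⟨hwZ, fun e => ha.2 ⟨ha.1, w, e, haw.symm⟩⟩
      have h2 := h1.trans ((Set.ncard_le_ncard hsub (Set.toFinite _)).trans (Set.ncard_union_le _ _))
      have h3 := Set.ncard_sdiff_add_ncard_of_subset (hY.trans Set.sdiff_subset) (Set.toFinite Z)
      omega)
    refine ⟨fun z => {w | w = z ∨ (z ∉ bdry G F₀ ∧ w = m z)}, fun z hz => ?_, ?_⟩
    · by_cases hzb : z ∈ bdry G F₀
      · have : {w | w = z ∨ (z ∉ bdry G F₀ ∧ w = m z)} = {z} := by ext; simp [hzb]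
        refine ⟨Or.inl rfl, ?_, ?_, z, Or.inl rfl, hzb⟩
        · simp only [this]; exact ConnOn.singleton G z
        · simp only [this]; exact Set.disjoint_singleton_left.2 hzb.1
      · have : {w | w = z ∨ (z ∉ bdry G F₀ ∧ w = m z)} = {z} ∪ {m z} := by ext; simp [hzb, or_comm]
        obtain ⟨h1, h2⟩ := hm z ⟨hz, hzb⟩
        refine ⟨Or.inl rfl, ?_, ?_, m z, Or.inr ⟨hzb, rfl⟩, h1.1⟩
        · simp only [this]
          exact (ConnOn.singleton G z).union (ConnOn.singleton G _) rfl rfl (Or.inr h2)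
        · simp only [this]
          rw [Set.disjoint_union_left, Set.disjoint_singleton_left,
            Set.disjoint_singleton_left]
          exact ⟨fun e => Set.disjoint_left.1 hFZ e hz, h1.1.1⟩
    · intro z hz z' hz' hne
      rw [Set.disjoint_left]
      rintro w (rfl | ⟨h1, rfl⟩) (h2 | ⟨h2, h3⟩)
      · exact hne h2
      · exact (hm z' ⟨hz', h2⟩).1.2 (h3 ▸ hz)
      · exact (hm z ⟨hz, h1⟩).1.2 (h2 ▸ hz')
      · exact hne (hminj ⟨hz, h1⟩ ⟨hz', h2⟩ h3)

end Menger

/-! ## Rooted clique minors -/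

section RootedMinor

variable {V : Type*}

/-- Suppose that `Z` is a clique and that there are at least `2|Z|` disjoint connected pairwise
adjacent sets `B i`, none of which can be separated from `Z` by fewer than `|Z|` vertices. Then
there are disjoint connected sets, one around every vertex of `Z`, that are pairwise joined by edges
not contained in `Z`. -/
theorem exists_rooted_minor [Finite V] {ι : Type*} [Finite ι] (G : SimpleGraph V) (U Z : Set V)
    (B : ι → Set V) (hU : ∀ a b, G.Adj a b → a ∈ U) (hZU : Z ⊆ U)
    (hZ : ∀ a ∈ Z, ∀ b ∈ Z, a ≠ b → G.Adj a b)
    (hB : ∀ i, ConnOn G (B i)) (hBU : ∀ i, B i ⊆ U)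
    (hBd : ∀ i j, i ≠ j → Disjoint (B i) (B j))
    (hBa : ∀ i j, i ≠ j → ∃ a ∈ B i, ∃ b ∈ B j, G.Adj a b)
    (hcard : 2 * Z.ncard ≤ Nat.card ι)
    (ht : ∀ i, Tough G U Z (B i)) :
    ∃ C : V → Set V, (∀ z ∈ Z, z ∈ C z ∧ ConnOn G (C z) ∧ C z ⊆ U) ∧
      (∀ z ∈ Z, ∀ z' ∈ Z, z ≠ z' → Disjoint (C z) (C z')) ∧
      (∀ z ∈ Z, ∀ z' ∈ Z, z ≠ z' →
        ∃ a ∈ C z, ∃ b ∈ C z', G.Adj a b ∧ ¬ (a ∈ Z ∧ b ∈ Z)) := by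
  classical
  induction hn : U.ncard using Nat.strong_induction_on generalizing G U Z B with
  | _ n ih =>
  subst hn
  by_cases hi : ∃ F i, B i ⊆ F ∧ F ⊆ U ∧ Disjoint F Z ∧
      (bdry G F).ncard = Z.ncard ∧ bdry G F ≠ Z
  · obtain ⟨F, i₀, hF, hFU, hFZ, hX, hbne⟩ := hi
    have hbU := bdry_subset hU F
    obtain ⟨C₁, hC₁, hd₁⟩ := Tough.exists_linkage G U Z F hU hZU hFU hFZ ((ht i₀).mono hF)
    obtain ⟨z, hz, hzb⟩ : ∃ z ∈ Z, z ∉ bdry G F := by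
      by_contra hcon
      push Not at hcon
      exact hbne (Set.eq_of_subset_of_ncard_le hcon hX.le (Set.toFinite _)).symm
    have hzF : z ∉ F := fun hh => Set.disjoint_left.1 hFZ hh hz
    set X := bdry G F with hXdef
    have hstep : ∀ a ∈ F, ∀ b, G.Adj a b → b ∈ F ∪ X := by
      intro a ha b hab
      by_cases hb : b ∈ F
      · exact Or.inl hb
      · exact Or.inr ⟨hb, a, ha, hab⟩
    have hBR : ∀ i, (B i ∩ (F ∪ X)).Nonempty := by
      intro i
      by_cases hii : i = i₀
      · obtain ⟨x, hx⟩ := (hB i).1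
        exact ⟨x, hx, Or.inl (hF (hii ▸ hx))⟩
      · obtain ⟨a, ha, b, hb, hab⟩ := hBa i₀ i (Ne.symm hii)
        exact ⟨b, hb, hstep a (hF ha) b hab⟩
    -- Every branch set meets `F ∪ X`, because it touches `B i₀ ⊆ F`; one that is not inside `F` has
    -- to pass through `X`.
    have hBX : ∀ i, ¬ B i ⊆ F → (B i ∩ X).Nonempty := by
      intro i hiF
      by_contra hcon
      have hno : ∀ x ∈ B i, x ∉ X := fun x hx hxX => hcon ⟨x, hx, hxX⟩
      obtain ⟨x, hx, hxR⟩ := hBR i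
      exact hiF ((hB i).subset_of_closed hx (hxR.resolve_right (hno x hx)) fun a b ha hab hb =>
        (hstep a ha b hab).resolve_right (hno b hb))
    -- The branch sets are restricted to `F ∪ X`. The added clique on `X` restores connectedness and
    -- adjacency wherever these were realised outside.
    obtain ⟨C₂, hC₂, hd₂, ha₂⟩ := ih _ (Set.ncard_lt_ncard (by
      refine ⟨Set.union_subset hFU hbU, fun hsub => ?_⟩
      exact (hsub (hZU hz)).elim hzF hzb) (Set.toFinite _))
      (DPLogic.torso G (F ∪ X) X) (F ∪ X) X (fun i => B i ∩ (F ∪ X))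
      (fun a b hab => hab.2.1) Set.subset_union_right
      (fun a ha b hb hne => ⟨hne, Or.inr ha, Or.inr hb, Or.inr ⟨ha, hb⟩⟩)
      (fun i => by
        have key : ∀ T ⊆ B i, T ⊆ F → T.Nonempty → (B i \ T).Nonempty →
            ∃ a ∈ T, ∃ b ∈ (B i ∩ (F ∪ X)) \ T, (DPLogic.torso G (F ∪ X) X).Adj a b := by
          intro T hT hTF hT1 hT2
          obtain ⟨a, ha, b, hb, hab⟩ := (hB i).2 T hT hT1 hT2
          have hbR := hstep a (hTF ha) b hab
          exact ⟨a, ha, b, ⟨⟨hb.1, hbR⟩, hb.2⟩, hab.ne, Or.inl (hTF ha), hbR, Or.inl hab⟩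
        refine ⟨hBR i, fun T hT hT1 hT2 => ?_⟩
        by_cases h1 : ∃ a ∈ T, a ∈ X
        · obtain ⟨a, ha, haX⟩ := h1
          by_cases h2 : ∃ b ∈ (B i ∩ (F ∪ X)) \ T, b ∈ X
          · obtain ⟨b, hb, hbX⟩ := h2
            exact ⟨a, ha, b, hb, fun e => hb.2 (e ▸ ha), Or.inr haX, Or.inr hbX, Or.inr ⟨haX, hbX⟩⟩
          · obtain ⟨x, hx, y, hy, hxy⟩ := key ((B i ∩ (F ∪ X)) \ T) (fun x hx => hx.1.1)
              (fun x hx => hx.1.2.resolve_right fun hxX => h2 ⟨x, hx, hxX⟩) hT2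
              ⟨a, (hT ha).1, fun hh => hh.2 ha⟩
            refine ⟨y, ?_, x, hx, hxy.symm⟩
            by_contra hyT
            exact hy.2 ⟨hy.1, hyT⟩
        · obtain ⟨b, hb⟩ := hT2
          exact key T (fun x hx => (hT hx).1)
            (fun x hx => (hT hx).2.resolve_right fun hxX => h1 ⟨x, hx, hxX⟩) hT1
            ⟨b, hb.1.1, hb.2⟩)
      (fun i => Set.inter_subset_right)
      (fun i j hij => (hBd i j hij).mono Set.inter_subset_left Set.inter_subset_left)
      (fun i j hij => by
        by_cases hX2 : (B i ∩ X).Nonempty ∧ (B j ∩ X).Nonempty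
        · obtain ⟨⟨a, ha, haX⟩, b, hb, hbX⟩ := hX2
          exact ⟨a, ⟨ha, Or.inr haX⟩, b, ⟨hb, Or.inr hbX⟩,
            fun e => Set.disjoint_left.1 (hBd i j hij) ha (e ▸ hb), Or.inr haX, Or.inr hbX,
            Or.inr ⟨haX, hbX⟩⟩
        · obtain ⟨a, ha, b, hb, hab⟩ := hBa i j hij
          have : a ∈ F ∪ X ∧ b ∈ F ∪ X := by
            by_cases h1 : B i ⊆ F
            · exact ⟨Or.inl (h1 ha), hstep a (h1 ha) b hab⟩
            · have h2 : B j ⊆ F := by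
                by_contra h2
                exact hX2 ⟨hBX i h1, hBX j h2⟩
              exact ⟨hstep b (h2 hb) a hab.symm, Or.inl (h2 hb)⟩
          exact ⟨a, ⟨ha, this.1⟩, b, ⟨hb, this.2⟩, hab.ne, this.1, this.2, Or.inl hab⟩)
      (by rw [hX]; exact hcard)
      (fun i => by
        by_cases hiF : B i ⊆ F
        · have : B i ∩ (F ∪ X) = B i :=
            Set.inter_eq_left.2 (hiF.trans Set.subset_union_left)
          rw [this]
          exact (ht i).torso hFU hFZ hX
        -- Toughness is vacuous here: a branch set meeting `X` lies in no set disjoint from `X`.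
        · obtain ⟨x, hx, hxX⟩ := hBX i hiF
          intro F' hF' _ hd
          exact absurd hxX (Set.disjoint_left.1 hd (hF' ⟨hx, Or.inr hxX⟩))) rfl
    obtain ⟨f, hf, hinj⟩ := exists_transversal hX (fun z hz => (hC₁ z hz).2.2.2) hd₁
    have h₂X : ∀ x ∈ X, ∀ y ∈ C₂ x, y ∈ X → y = x := by
      intro x hx y hy hyb
      by_contra hne
      exact Set.disjoint_left.1 (hd₂ x hx y hyb (Ne.symm hne)) hy (hC₂ y hyb).1
    have hC₂' : ∀ x ∈ X, ConnOn G (C₂ x) ∧ C₂ x ⊆ F ∪ X := fun x hx =>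
      (hC₂ x hx).2.1.of_torso (hC₂ x hx).1 (Or.inr hx) (h₂X x hx)
    refine ⟨fun z => C₁ z ∪ C₂ (f z), fun z hz => ?_, glue_disjoint hf hinj
      (fun z hz => (hC₁ z hz).2.2.1) hd₁ (fun x hx => (hC₂' x hx).2) h₂X hd₂, ?_⟩
    · obtain ⟨a1, a2, a3, a4⟩ := hC₁ z hz
      obtain ⟨b1, b2⟩ := hf z hz
      have hfz : f z ∈ C₁ z := (b2.symm.subset rfl).1
      refine ⟨Or.inl a1, a2.union (hC₂' _ b1).1 hfz (hC₂ _ b1).1 (Or.inl rfl), ?_⟩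
      exact Set.union_subset (a2.subset_of_closed a1 (hZU hz) fun a b _ hab _ => hU b a hab.symm)
        ((hC₂' _ b1).2.trans (Set.union_subset hFU hbU))
    · intro z hz z' hz' hne
      obtain ⟨a, ha, b, hb, hab, habX⟩ := ha₂ _ (hf z hz).1 _ (hf z' hz').1
        fun e => hne (hinj hz hz' e)
      -- An edge not within `X` is a genuine edge of `G`. It is not within `Z` either, since
      -- vertices of `Z` in `F ∪ X` belong to `X`.
      refine ⟨a, Or.inr ha, b, Or.inr hb, hab.2.2.2.resolve_right habX, fun habZ => habX ?_⟩
      exact ⟨hab.2.1.resolve_left fun e => Set.disjoint_left.1 hFZ e habZ.1,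
        hab.2.2.1.resolve_left fun e => Set.disjoint_left.1 hFZ e habZ.2⟩
  by_cases hii : ∃ u v, G.Adj u v ∧ v ∉ Z ∧ ∀ i, v ∈ B i → u ∈ B i
  · obtain ⟨u, v, huv, hvZ, huvB⟩ := hii
    have hvU : v ∈ U := hU v u huv.symm
    have huU : u ∈ U := hU u v huv
    have hU' : ∀ a b, (DPLogic.contract G u v).Adj a b → a ∈ U \ {v} := by
      rintro a b ⟨h1, h2, h3, h4⟩
      refine ⟨?_, h2⟩
      rcases h4 with h4 | ⟨rfl, h4⟩ | ⟨-, h4⟩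
      exacts [hU _ _ h4, huU, hU _ _ h4]
    have hZU' : Z ⊆ U \ {v} := fun z hz => ⟨hZU hz, fun e => hvZ (e ▸ hz)⟩
    have hZv : ∀ z ∈ Z, z ≠ v := fun z hz e => hvZ (e ▸ hz)
    obtain ⟨C, hC, hd, hadj⟩ := ih _ (Set.ncard_lt_ncard (by
      refine ⟨Set.sdiff_subset, fun hsub => ?_⟩
      exact (hsub hvU).2 rfl) (Set.toFinite _)) (DPLogic.contract G u v) (U \ {v}) Z
      (fun i => B i \ {v}) hU' hZU'
      (fun a ha b hb hne => ⟨hne, hZv a ha, hZv b hb, Or.inl (hZ a ha b hb hne)⟩)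
      (fun i => (hB i).contract huv.ne (huvB i))
      (fun i => Set.sdiff_subset_sdiff_left (hBU i))
      (fun i j hij => (hBd i j hij).mono Set.sdiff_subset Set.sdiff_subset)
      (fun i j hij => by
        obtain ⟨a, ha, b, hb, hab⟩ := hBa i j hij
        by_cases hav : a = v
        · subst hav
          have hbu : u ≠ b := fun e =>
            Set.disjoint_left.1 (hBd i j hij) (huvB i ha) (e ▸ hb)
          exact ⟨u, ⟨huvB i ha, huv.ne⟩, b, ⟨hb, hab.ne'⟩, hbu, huv.ne, hab.ne',
            Or.inr (Or.inl ⟨rfl, hab⟩)⟩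
        · by_cases hbv : b = v
          · subst hbv
            have hau : a ≠ u := fun e =>
              Set.disjoint_left.1 (hBd i j hij) ha (e ▸ huvB j hb)
            exact ⟨a, ⟨ha, hav⟩, u, ⟨huvB j hb, huv.ne⟩, hau, hav, huv.ne,
              Or.inr (Or.inr ⟨rfl, hab⟩)⟩
          · exact ⟨a, ⟨ha, hav⟩, b, ⟨hb, hbv⟩, hab.ne, hav, hbv, Or.inl hab⟩)
      hcard
      (fun i => (ht i).contract huv.ne hvU hvZ (huvB i) fun F hF hFU hFZ hX hvF =>
        hi ⟨F, i, hF, hFU, hFZ, hX, fun e => hvZ (e ▸ hvF)⟩) rfl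
    have hvC : ∀ z ∈ Z, v ∉ C z := fun z hz hvz => ((hC z hz).2.2 hvz).2 rfl
    refine ⟨fun z => expand u v (C z), fun z hz => ?_, fun z hz z' hz' hne =>
      expand_disjoint (hvC z hz) (hvC z' hz') (hd z hz z' hz' hne), fun z hz z' hz' hne => ?_⟩
    · obtain ⟨a1, a2, a3⟩ := hC z hz
      refine ⟨Or.inl a1, a2.expand huv, ?_⟩
      rintro w (hw | ⟨rfl, -⟩)
      · exact (a3 hw).1
      · exact hvU
    · obtain ⟨a, ha, b, hb, ⟨h1, h2, h3, h4⟩, h5⟩ := hadj z hz z' hz' hne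
      rcases h4 with h4 | ⟨rfl, h4⟩ | ⟨rfl, h4⟩
      · exact ⟨a, Or.inl ha, b, Or.inl hb, h4, h5⟩
      · exact ⟨v, Or.inr ⟨rfl, ha⟩, b, Or.inl hb, h4, fun e => hvZ e.1⟩
      · exact ⟨a, Or.inl ha, v, Or.inr ⟨rfl, hb⟩, h4, fun e => hvZ e.2⟩
  -- Without contractible edges, every non-isolated vertex outside `Z` is by itself a branch set;
  -- these vertices form `Q`.
  · push Not at hii
    set Q : Set V := {v | v ∉ Z ∧ ∃ i, B i = {v}} with hQ
    have hQ1 : ∀ i, ∀ v ∈ B i, v ∉ Z → B i = {v} := by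
      intro i v hv hvZ
      by_contra hne
      have : (B i \ {v}).Nonempty := by
        by_contra hcon
        rw [Set.not_nonempty_iff_eq_empty, Set.sdiff_eq_empty] at hcon
        exact hne (Set.Subset.antisymm hcon (Set.singleton_subset_iff.2 hv))
      obtain ⟨a, rfl, b, hb, hab⟩ := (hB i).2 {v} (Set.singleton_subset_iff.2 hv) ⟨v, rfl⟩ this
      obtain ⟨j, hj, hbj⟩ := hii b a hab.symm hvZ
      by_cases hij : i = j
      · exact hbj (hij ▸ hb.1)
      · exact Set.disjoint_left.1 (hBd i j hij) hv hj
    have hQ2 : ∀ u v, G.Adj u v → v ∉ Z → v ∈ Q := by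
      intro u v huv hvZ
      obtain ⟨i, hi, -⟩ := hii u v huv hvZ
      exact ⟨hvZ, i, hQ1 i v hi hvZ⟩
    -- At most `|Z|` of the at least `2|Z|` disjoint branch sets meet `Z`; the others are distinct
    -- singletons in `Q`.
    have hQcard : Z.ncard ≤ Q.ncard := by
      choose g hg using fun i => (hB i).1
      have hginj : Function.Injective g := by
        intro i j hij
        by_contra hne
        exact Set.disjoint_left.1 (hBd i j hne) (hg i) (hij ▸ hg j)
      have h1 : Set.range g ⊆ Z ∪ Q := by
        rintro _ ⟨i, rfl⟩
        by_cases hgZ : g i ∈ Z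
        · exact Or.inl hgZ
        · exact Or.inr ⟨hgZ, i, hQ1 i _ (hg i) hgZ⟩
      have h2 := (Set.ncard_le_ncard h1 (Set.toFinite _)).trans (Set.ncard_union_le _ _)
      rw [← Set.image_univ, Set.ncard_image_of_injective _ hginj, Set.ncard_univ] at h2
      omega
    obtain ⟨m, hm, hminj⟩ := exists_matching (A := Z) (B := Q) G.Adj (by
      intro Y hY
      set N := {b | b ∈ Q ∧ ∃ a ∈ Y, G.Adj a b} with hN
      by_contra hlt
      push Not at hlt
      have hNQ : N ⊆ Q := fun b hb => hb.1
      have hYZ := Set.ncard_le_ncard hY (Set.toFinite _)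
      obtain ⟨q, hq, hqN⟩ : ∃ q ∈ Q, q ∉ N := by
        by_contra hcon
        push Not at hcon
        have := Set.ncard_le_ncard (show Q ⊆ N from hcon) (Set.toFinite _)
        omega
      obtain ⟨i, hiq⟩ := hq.2
      -- If `Y` violated Hall's condition, `Q \ N` would contain the branch set `{q}` while its
      -- boundary, inside `N ∪ (Z \ Y)`, had fewer than `|Z|` vertices.
      have h1 := ht i (Q \ N) (by rw [hiq]; exact Set.singleton_subset_iff.2 ⟨hq, hqN⟩)
        (by
          rintro x ⟨⟨-, j, hj⟩, -⟩
          exact hBU j (by rw [hj]; rfl))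
        (Set.disjoint_left.2 fun x hx => hx.1.1)
      have hsub : bdry G (Q \ N) ⊆ N ∪ (Z \ Y) := by
        rintro w ⟨hw, a, ha, haw⟩
        by_cases hwZ : w ∈ Z
        · exact Or.inr ⟨hwZ, fun hwY => ha.2 ⟨ha.1, w, hwY, haw.symm⟩⟩
        · refine Or.inl ?_
          by_contra hwN
          exact hw ⟨hQ2 a w haw hwZ, hwN⟩
      have h2 := h1.trans ((Set.ncard_le_ncard hsub (Set.toFinite _)).trans (Set.ncard_union_le _ _))
      have h3 := Set.ncard_sdiff_add_ncard_of_subset hY (Set.toFinite Z)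
      omega)
    have hmZ : ∀ z ∈ Z, m z ∉ Z := fun z hz => (hm z hz).1.1
    refine ⟨fun z => {z} ∪ {m z}, fun z hz => ?_, fun z hz z' hz' hne => ?_,
      fun z hz z' hz' hne => ?_⟩
    · refine ⟨Or.inl rfl, (ConnOn.singleton G z).union (ConnOn.singleton G _) rfl rfl
        (Or.inr (hm z hz).2), ?_⟩
      rintro x (rfl | rfl)
      · exact hZU hz
      · exact hU _ _ (hm z hz).2.symm
    · rw [Set.disjoint_left]
      rintro w (rfl | rfl) (h | h)
      · exact hne h
      · exact hmZ z' hz' (h ▸ hz)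
      · exact hmZ z hz ((show m z = z' from h) ▸ hz')
      · exact hne (hminj hz hz' h)
    · obtain ⟨i, hi⟩ := (hm z hz).1.2
      obtain ⟨j, hj⟩ := (hm z' hz').1.2
      have hij : i ≠ j := by
        rintro rfl
        exact hne (hminj hz hz' (Set.singleton_injective (hi.symm.trans hj)))
      obtain ⟨a, ha, b, hb, hab⟩ := hBa i j hij
      rw [hi] at ha
      rw [hj] at hb
      obtain rfl : a = m z := ha
      obtain rfl : b = m z' := hb
      exact ⟨_, Or.inr rfl, _, Or.inr rfl, hab, fun e => hmZ z hz e.1⟩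

end RootedMinor

/-! ## Linking terminals through a clique minor -/

section Linking

variable {V : Type*}

theorem ConnOn.exists_path {G : SimpleGraph V} {S : Set V} (hS : ConnOn G S) {a b : V}
    (ha : a ∈ S) (hb : b ∈ S) : ∃ P : G.Path a b, ∀ v ∈ P.1.support, v ∈ S := by
  classical
  have hsub : S ⊆ {v | ∃ p : G.Walk a v, ∀ w ∈ p.support, w ∈ S} := by
    refine hS.subset_of_closed ha ⟨.nil, by simpa using ha⟩ ?_
    rintro c d ⟨p, hp⟩ hcd hd
    refine ⟨p.concat hcd, fun w hw => ?_⟩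
    rw [SimpleGraph.Walk.support_concat] at hw
    rcases (by simpa using hw : w ∈ p.support ∨ w = d) with h | h
    · exact hp w h
    · exact h ▸ hd
  obtain ⟨p, hp⟩ := hsub hb
  exact ⟨p.toPath, fun v hv => hp v (p.support_bypass_subset_support hv)⟩

theorem ConnOn.of_induce {G : SimpleGraph V} {S : Set V} (h : (G.induce S).Connected) :
    ConnOn G S := by
  refine ⟨?_, fun T hT ⟨a, ha⟩ ⟨b, hb⟩ => ?_⟩
  · obtain ⟨x⟩ := h.nonempty
    exact ⟨x, x.2⟩
  · obtain ⟨p⟩ := h.preconnected ⟨a, hT ha⟩ ⟨b, hb.1⟩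
    obtain ⟨d, -, h1, h2⟩ := p.exists_boundary_dart (Subtype.val ⁻¹' T) ha hb.2
    exact ⟨d.fst, h1, d.snd, ⟨d.snd.2, h2⟩, d.adj⟩

theorem ConnOn.image {V' : Type*} {G : SimpleGraph V} {H : SimpleGraph V'} {S : Set V}
    (hS : ConnOn G S) (f : V → V')
    (hf : ∀ a ∈ S, ∀ b ∈ S, G.Adj a b → H.Adj (f a) (f b)) : ConnOn H (f '' S) := by
  refine ⟨hS.1.image f, ?_⟩
  rintro T hT ⟨a, ha⟩ ⟨b, ⟨b', hb', rfl⟩, hb⟩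
  obtain ⟨a', ha', rfl⟩ := hT ha
  obtain ⟨c, hc, d, hd, hcd⟩ := hS.2 (S ∩ f ⁻¹' T) Set.inter_subset_left ⟨a', ha', ha⟩
    ⟨b', hb', fun h => hb h.2⟩
  exact ⟨f c, hc.2, f d, ⟨⟨d, hd.1, rfl⟩, fun h => hd.2 ⟨hd.1, h⟩⟩, hf c hc.1 d hd.1 hcd⟩

/-- Connected sets containing the pairs of terminals and overlapping only in common terminals
yield internally disjoint paths. -/
theorem DP.of_connOn {G : SimpleGraph V} {k : ℕ} {s t : Fin k → V} (M : Fin k → Set V)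
    (hM : ∀ i, ConnOn G (M i)) (hs : ∀ i, s i ∈ M i) (ht : ∀ i, t i ∈ M i)
    (hd : ∀ i j, i ≠ j → ∀ v ∈ M i, v ∈ M j → v = s i ∨ v = t i) : DP G s t := by
  choose P hP using fun i => (hM i).exists_path (hs i) (ht i)
  refine ⟨P, fun i j hij => ⟨fun v hv hv' => ?_, fun v hv hv' => ?_⟩⟩
  · exact (hd j i hij.symm v (hP j v hv'.1) (hP i v hv)).elim hv'.2.1 hv'.2.2
  · exact (hd i j hij v (hP i v hv'.1) (hP j v hv)).elim hv'.2.1 hv'.2.2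

/-- The set `D` contains `T`, and the vertices of `D \ S` have no neighbours outside `D ⊇ S`. -/
structure IsCut (G : SimpleGraph V) (T D S : Set V) : Prop where
  sub : S ⊆ D
  cover : T ⊆ D
  closed : ∀ v ∈ D, v ∉ S → ∀ z, G.Adj v z → z ∈ D

/-- The copies of the vertices of `S`: `k` copies of every terminal and one copy of every other
vertex. -/
def copies (T : Set V) (k : ℕ) (S : Set V) : Set (V × Fin k) :=
  {p | p.1 ∈ S ∧ (p.1 ∈ T ∨ p.2.val = 0)}

/-- The weight of `S`, where the vertices in `T` have weight `k` and all others have weight `1`. -/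
noncomputable def wt (T : Set V) (k : ℕ) (S : Set V) : ℕ := (copies T k S).ncard

theorem ncard_le_wt [Finite V] (T : Set V) {k : ℕ} (hk : 1 ≤ k) (S : Set V) :
    S.ncard ≤ wt T k S := by
  have h : (fun v => ((v, ⟨0, hk⟩) : V × Fin k)) '' S ⊆ copies T k S := by
    rintro _ ⟨v, hv, rfl⟩
    exact ⟨hv, Or.inr rfl⟩
  have := Set.ncard_le_ncard h (Set.toFinite _)
  rwa [Set.ncard_image_of_injective _ fun a b h => congrArg Prod.fst h] at this

/-- A clique minor given by connected disjoint pairwise adjacent branch sets. -/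
structure IsModel {ι : Type*} (G : SimpleGraph V) (B : ι → Set V) : Prop where
  conn : ∀ i, ConnOn G (B i)
  disj : ∀ i j, i ≠ j → Disjoint (B i) (B j)
  adj : ∀ i j, i ≠ j → ∃ a ∈ B i, ∃ b ∈ B j, G.Adj a b

theorem IsMinor.exists_isModel {G : SimpleGraph V} {t : ℕ}
    (h : IsMinor (⊤ : SimpleGraph (Fin t)) G) : ∃ B : Fin t → Set V, IsModel G B := by
  obtain ⟨B, h1, h2, h3⟩ := h
  exact ⟨B, fun i => ConnOn.of_induce (h1 i), h2, fun i j hij => h3 i j hij⟩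

/-- In a family of disjoint sets, at most `|S|` of them meet `S`. -/
theorem ncard_meet_le [Finite V] {ι : Type*} [Finite ι] {B : ι → Set V}
    (hB : ∀ i j, i ≠ j → Disjoint (B i) (B j)) (S : Set V) :
    {i | ¬ Disjoint (B i) S}.ncard ≤ S.ncard := by
  have : ∀ i ∈ {i | ¬ Disjoint (B i) S}, ∃ v ∈ B i, v ∈ S := fun i hi => Set.not_disjoint_iff.1 hi
  rcases isEmpty_or_nonempty V with hV | hV
  · rw [Set.eq_empty_of_forall_notMem fun i hi => hV.elim (this i hi).choose]
    simp
  choose! g hg1 hg2 using this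
  refine Set.ncard_le_ncard_of_injOn g hg2 (fun i hi j hj hij => ?_) (Set.toFinite _)
  by_contra hne
  exact Set.disjoint_left.1 (hB i j hne) (hg1 i hi) (hij ▸ hg1 j hj)

/-- In an unbreakable graph, a side of a small separation is small if it misses a branch set of a
large clique minor. -/
theorem IsCut.ncard_le [Finite V] {G : SimpleGraph V} {L p t : ℕ} (hG : IsUnbreakable G L p)
    {B : Fin t → Set V} (hB : IsModel G B) (hLt : L < t) {T D S : Set V} (h : IsCut G T D S)
    (hS : S.ncard ≤ p) {w : Fin t} (hw : Disjoint (B w) D) : D.ncard ≤ L := by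
  have hmeet : ∀ i, ¬ Disjoint (B i) (D \ S)ᶜ := by
    intro i
    rw [Set.not_disjoint_iff]
    by_cases hiw : i = w
    · obtain ⟨x, hx⟩ := (hB.conn i).1
      exact ⟨x, hx, fun hxD => Set.disjoint_left.1 hw (hiw ▸ hx) hxD.1⟩
    · obtain ⟨a, ha, b, hb, hab⟩ := hB.adj w i (Ne.symm hiw)
      exact ⟨b, hb, fun hbD => Set.disjoint_left.1 hw ha (h.closed b hbD.1 hbD.2 a hab.symm)⟩
  have hcard : t ≤ (D \ S)ᶜ.ncard := by
    have h1 := ncard_meet_le hB.disj (D \ S)ᶜ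
    rw [show {i | ¬ Disjoint (B i) (D \ S)ᶜ} = Set.univ from Set.eq_univ_of_forall hmeet,
      Set.ncard_univ, Nat.card_eq_fintype_card, Fintype.card_fin] at h1
    exact h1
  -- The two sides meet exactly in `S`. The far side meets all `t > L` branch sets, so the side `D`
  -- must be the small one.
  have hsep := hG ((⊤ : G.Subgraph).induce D) ((⊤ : G.Subgraph).induce (D \ S)ᶜ) ⟨by
      ext v; by_cases hv : v ∈ D <;> simp [hv], by
      rintro u ⟨hu1, hu2⟩ v ⟨hv1, hv2⟩ huv
      have hu : u ∈ D \ S := not_not.1 hu2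
      exact hv2 (h.closed u hu.1 hu.2 v huv)⟩ (by
      have : D ∩ (D \ S)ᶜ = S := by
        ext v
        have := @h.sub v
        simp
        tauto
      simpa [this] using hS)
  simp only [SimpleGraph.Subgraph.induce_verts, SimpleGraph.Subgraph.verts_top,
    Set.inter_univ] at hsep
  omega

end Linking

/-! ### Linking through copies of a minimum-weight separator -/

section Linking

variable {V : Type*}

/-- The index of the pair containing a terminal. -/
def pairIndex {k : ℕ} : Term2 k → Fin k := Sum.elim id id

/-- Terminals that are connected to each other, or to a separator of minimum weight, inside the
cut-off part of an unbreakable graph can be linked through a large clique minor. -/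
theorem DP.of_isCut [Finite V] {G : SimpleGraph V} {k L p t : ℕ} (hk : 1 ≤ k)
    (hG : IsUnbreakable G L p) {B : Fin t → Set V} (hB : IsModel G B) (hLt : L < t)
    (x : Term2 k → V) {D S : Set V} (hcut : IsCut G (Set.range x) D S)
    (hmin : ∀ D' S', IsCut G (Set.range x) D' S' → D'.ncard ≤ L →
      wt (Set.range x) k S ≤ wt (Set.range x) k S')
    (hp : wt (Set.range x) k S ≤ p) (ht : 3 * wt (Set.range x) k S ≤ t)
    (hBS : ∀ w, Disjoint (B w) S → Disjoint (B w) D)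
    (W : Term2 k → Set V) (e : Term2 k → V)
    (hW : ∀ a, ConnOn G (W a) ∧ x a ∈ W a ∧ e a ∈ W a ∧ W a ⊆ D)
    (hend : ∀ i, e (.inl i) = e (.inr i) ∨ (e (.inl i) ∈ S ∧ e (.inr i) ∈ S))
    (hdisj : ∀ a b, pairIndex a ≠ pairIndex b → ∀ v ∈ W a, v ∈ W b →
      v = x (.inl (pairIndex a)) ∨ v = x (.inr (pairIndex a))) :
    DP G (fun i => x (.inl i)) (fun i => x (.inr i)) := by
  classical
  set T := Set.range x with hT
  set o : Fin k := ⟨0, hk⟩ with ho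
  set Z := copies T k S with hZ
  -- Vertices outside `D` get a single copy, at index `o`; `D \ S` is dropped.
  set U : Set (V × Fin k) := Z ∪ {q | q.1 ∉ D ∧ q.2 = o} with hU
  let H := torso (G.comap Prod.fst) U Z
  have hUZ : ∀ q ∈ U, q.1 ∈ D → q ∈ Z := fun q hq hqD => hq.resolve_right fun h => h.1 hqD
  let ι := {w : Fin t // Disjoint (B w) D}
  have hι : 2 * Z.ncard ≤ Nat.card ι := by
    have h1 := ncard_meet_le hB.disj S
    have h2 : {w | ¬ Disjoint (B w) D} ⊆ {w | ¬ Disjoint (B w) S} := fun w hw hw' => hw (hBS w hw')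
    have h3 := Set.ncard_le_ncard h2 (Set.toFinite _)
    have h4 := Set.ncard_add_ncard_compl {w | Disjoint (B w) D}
    have h5 : Nat.card ι = {w | Disjoint (B w) D}.ncard := Nat.card_coe_set_eq _
    have h6 : {w | Disjoint (B w) D}ᶜ = {w | ¬ Disjoint (B w) D} := rfl
    have h7 := ncard_le_wt T hk S
    rw [Nat.card_eq_fintype_card, Fintype.card_fin, h6] at h4
    have h8 : Z.ncard = wt T k S := rfl
    omega
  obtain ⟨C, hC, hCd, hCa⟩ := exists_rooted_minor H U Z
    (fun i : ι => (fun v => (v, o)) '' B i.1) (fun a b hab => hab.2.1) Set.subset_union_left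
    (fun a ha b hb hne => ⟨hne, Or.inl ha, Or.inl hb, Or.inr ⟨ha, hb⟩⟩)
    (fun i => (hB.conn i.1).image _ fun a ha b hb hab =>
      ⟨fun h => hab.ne (congrArg Prod.fst h), Or.inr ⟨Set.disjoint_left.1 i.2 ha, rfl⟩,
        Or.inr ⟨Set.disjoint_left.1 i.2 hb, rfl⟩, Or.inl hab⟩)
    (fun i => by
      rintro _ ⟨v, hv, rfl⟩
      exact Or.inr ⟨Set.disjoint_left.1 i.2 hv, rfl⟩)
    (fun i j hij => by
      rw [Set.disjoint_left]
      rintro _ ⟨v, hv, rfl⟩ ⟨v', hv', h⟩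
      have : v' = v := congrArg Prod.fst h
      exact Set.disjoint_left.1 (hB.disj i.1 j.1 fun h => hij (Subtype.ext h)) hv (this ▸ hv'))
    (fun i j hij => by
      obtain ⟨a, ha, b, hb, hab⟩ := hB.adj i.1 j.1 fun h => hij (Subtype.ext h)
      exact ⟨_, ⟨a, ha, rfl⟩, _, ⟨b, hb, rfl⟩, fun h => hab.ne (congrArg Prod.fst h),
        Or.inr ⟨Set.disjoint_left.1 i.2 ha, rfl⟩, Or.inr ⟨Set.disjoint_left.1 j.2 hb, rfl⟩,
        Or.inl hab⟩)
    hι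
    (fun i F hF hFU hFZ => by
      by_contra hlt
      push Not at hlt
      -- A set `F` violating toughness yields the cut with terminal side `F₀ᶜ` and separator `∂F₀`.
      -- All copies of `∂F₀` lie in the boundary of `F`, so this cut weighs less than `S`.
      set F₀ : Set V := {v | v ∉ D ∧ (v, o) ∈ F} with hF₀
      have hTD := hcut.cover
      have hcut' : IsCut G T F₀ᶜ (bdry G F₀) := by
        refine ⟨fun v hv => hv.1, fun v hv h => h.1 (hTD hv), fun v hv hvb z hvz hz => ?_⟩
        exact hvb ⟨hv, z, hz, hvz.symm⟩
      have hsub : copies T k (bdry G F₀) ⊆ bdry H F := by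
        rintro ⟨v, c⟩ ⟨⟨hv, a, ha, hav⟩, hc⟩
        have haU : (a, o) ∈ U := Or.inr ⟨ha.1, rfl⟩
        have hne : (a, o) ≠ (v, c) := fun h => hav.ne (congrArg Prod.fst h)
        by_cases hvD : v ∈ D
        · have hvS : v ∈ S := by
            by_contra hvS
            exact ha.1 (hcut.closed v hvD hvS a hav.symm)
          have hvZ : (v, c) ∈ Z := ⟨hvS, hc⟩
          exact ⟨fun h => Set.disjoint_left.1 hFZ h hvZ, (a, o), ha.2, hne, haU, Or.inl hvZ,
            Or.inl hav⟩
        · have hco : c = o := Fin.ext (hc.resolve_left fun h => hvD (hTD h))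
          subst hco
          exact ⟨fun h => hv ⟨hvD, h⟩, (a, o), ha.2, hne, haU, Or.inr ⟨hvD, rfl⟩, Or.inl hav⟩
      have hwt : wt T k (bdry G F₀) < wt T k S :=
        (Set.ncard_le_ncard hsub (Set.toFinite _)).trans_lt hlt
      have hw : Disjoint (B i.1) F₀ᶜ := by
        rw [Set.disjoint_left]
        exact fun v hv h => h ⟨Set.disjoint_left.1 i.2 hv, hF ⟨v, hv, rfl⟩⟩
      have := hmin _ _ hcut' (hcut'.ncard_le hG hB hLt
        ((ncard_le_wt T hk _).trans (hwt.le.trans hp)) hw)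
      omega)
  have hCZ : ∀ z ∈ Z, ∀ q ∈ C z, q ∈ Z → q = z := by
    intro z hz q hq hqZ
    by_contra hne
    exact Set.disjoint_left.1 (hCd z hz q hqZ (Ne.symm hne)) hq (hC q hqZ).1
  have hπ : ∀ z ∈ Z, ConnOn G (Prod.fst '' C z) := by
    intro z hz
    refine (hC z hz).2.1.image _ fun a ha b hb hab => ?_
    rcases hab.2.2.2 with h | h
    · exact h
    · exact absurd ((hCZ z hz a ha h.1).trans (hCZ z hz b hb h.2).symm) hab.1
  -- Walks of different pairs may end in the same vertex only if it is a terminal; each pair then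
  -- takes the copy with its own index.
  let z : Term2 k → V × Fin k := fun a => (e a, if e a ∈ T then pairIndex a else o)
  have hzZ : ∀ a, e a ∈ S → z a ∈ Z := by
    intro a ha
    refine ⟨ha, ?_⟩
    by_cases h : e a ∈ T
    · exact Or.inl h
    · right
      simp [z, h, ho]
  -- A pair whose walks already meet needs nothing outside `D`; otherwise each walk is prolonged by
  -- the projected set rooted at its end.
  let E : Term2 k → Set V := fun a =>
    if e (.inl (pairIndex a)) = e (.inr (pairIndex a)) then ∅ else Prod.fst '' C (z a)
  have hSa : ∀ a, e (.inl (pairIndex a)) ≠ e (.inr (pairIndex a)) → e a ∈ S := by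
    intro a ha
    have := (hend (pairIndex a)).resolve_left ha
    rcases a with i | i
    exacts [this.1, this.2]
  have hE : ∀ a, ∀ v ∈ E a, ∃ q ∈ C (z a), q.1 = v ∧ z a ∈ Z := by
    intro a v hv
    by_cases h : e (.inl (pairIndex a)) = e (.inr (pairIndex a))
    · simp [E, h] at hv
    · simp only [E, h, if_false] at hv
      obtain ⟨q, hq, rfl⟩ := hv
      exact ⟨q, hq, rfl, hzZ a (hSa a h)⟩
  have hED : ∀ a, ∀ v ∈ E a, v ∈ D → v = e a := by
    intro a v hv hvD
    obtain ⟨q, hq, rfl, hz⟩ := hE a v hv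
    rw [hCZ _ hz q hq (hUZ q ((hC _ hz).2.2 hq) hvD)]
  have hEE : ∀ a b, pairIndex a ≠ pairIndex b → ∀ v ∈ E a, v ∈ E b → v ∈ D := by
    intro a b hab v hva hvb
    by_contra hvD
    obtain ⟨q, hq, rfl, hza⟩ := hE a v hva
    obtain ⟨r, hr, hrq, hzb⟩ := hE b q.1 hvb
    have hq2 := ((hC _ hza).2.2 hq).resolve_left fun h => hvD (hcut.sub h.1)
    have hr2 := ((hC _ hzb).2.2 hr).resolve_left fun h => hvD (hrq ▸ hcut.sub h.1)
    have hqr : q = r := Prod.ext hrq.symm (hq2.2.trans hr2.2.symm)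
    have hzz : z a = z b := by
      by_contra hne
      exact Set.disjoint_left.1 (hCd _ hza _ hzb hne) hq (hqr ▸ hr)
    have he : e a = e b := congrArg Prod.fst hzz
    have heT : e a ∈ T := by
      rcases hdisj a b hab (e a) (hW a).2.2.1 (he ▸ (hW b).2.2.1) with h | h <;> rw [h] <;>
        exact ⟨_, rfl⟩
    have h2 := congrArg Prod.snd hzz
    simp only [z, heT, he ▸ heT, if_true] at h2
    exact hab h2
  let M : Term2 k → Set V := fun a => W a ∪ E a
  have hMD : ∀ a, ∀ v ∈ M a, v ∈ D → v ∈ W a := by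
    rintro a v (hv | hv) hvD
    · exact hv
    · rw [hED a v hv hvD]
      exact (hW a).2.2.1
  have hMM : ∀ a b, pairIndex a ≠ pairIndex b → ∀ v ∈ M a, v ∈ M b →
      v = x (.inl (pairIndex a)) ∨ v = x (.inr (pairIndex a)) := by
    intro a b hab v hva hvb
    have hvD : v ∈ D := by
      rcases hva with h | h
      · exact (hW a).2.2.2 h
      · rcases hvb with h' | h'
        · exact (hW b).2.2.2 h'
        · exact hEE a b hab v h h'
    exact hdisj a b hab v (hMD a v hva hvD) (hMD b v hvb hvD)
  have hMconn : ∀ i, ConnOn G (M (.inl i) ∪ M (.inr i)) := by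
    intro i
    by_cases h : e (.inl i) = e (.inr i)
    · have h1 : M (.inl i) = W (.inl i) := by simp [M, E, pairIndex, h]
      have h2 : M (.inr i) = W (.inr i) := by simp [M, E, pairIndex, h]
      rw [h1, h2]
      exact (hW _).1.union (hW _).1 (hW _).2.2.1 (hW _).2.2.1 (Or.inl h)
    · have hz1 := hzZ (.inl i) (hSa (.inl i) h)
      have hz2 := hzZ (.inr i) (hSa (.inr i) h)
      have h1 : M (.inl i) = W (.inl i) ∪ Prod.fst '' C (z (.inl i)) := by
        simp [M, E, pairIndex, h]
      have h2 : M (.inr i) = W (.inr i) ∪ Prod.fst '' C (z (.inr i)) := by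
        simp [M, E, pairIndex, h]
      rw [h1, h2]
      have c1 := (hW (.inl i)).1.union (hπ _ hz1) (hW _).2.2.1 ⟨_, (hC _ hz1).1, rfl⟩ (Or.inl rfl)
      have c2 := (hW (.inr i)).1.union (hπ _ hz2) (hW _).2.2.1 ⟨_, (hC _ hz2).1, rfl⟩ (Or.inl rfl)
      -- The joining edge is not within `Z`, so it is not an artificial clique edge and projects to
      -- an edge of `G`.
      obtain ⟨a, ha, b, hb, hab, habZ⟩ := hCa _ hz1 _ hz2 fun hh => h (congrArg Prod.fst hh)
      exact c1.union c2 (Or.inr ⟨a, ha, rfl⟩) (Or.inr ⟨b, hb, rfl⟩)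
        (Or.inr (hab.2.2.2.resolve_right habZ))
  refine DP.of_connOn (fun i => M (.inl i) ∪ M (.inr i)) hMconn
    (fun i => Or.inl (Or.inl (hW _).2.1)) (fun i => Or.inr (Or.inl (hW _).2.1)) ?_
  rintro i j hij v (hv | hv) (hv' | hv')
  · exact hMM (.inl i) (.inl j) hij v hv hv'
  · exact hMM (.inl i) (.inr j) hij v hv hv'
  · exact hMM (.inr i) (.inl j) hij v hv hv'
  · exact hMM (.inr i) (.inr j) hij v hv hv'

end Linking

/-! ## Semantics of the formulas -/

section Semantics

variable {V : Type*} {α : Type} (G : SimpleGraph V) (v : α → V)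

theorem graphRealize_eqF (a b : α) : GraphRealize G (eqF a b) v ↔ v a = v b := by
  let _ := G.structure
  simp [GraphRealize, eqF, Formula.Realize, Term.equal]

theorem graphRealize_adjF (a b : α) : GraphRealize G (adjF a b) v ↔ G.Adj (v a) (v b) := by
  let _ := G.structure
  simp only [GraphRealize, adjF, Formula.realize_rel₂]
  rfl

theorem graphRealize_inf (φ ψ : Language.graph.Formula α) :
    GraphRealize G (φ ⊓ ψ) v ↔ GraphRealize G φ v ∧ GraphRealize G ψ v := by
  let _ := G.structure
  exact Formula.realize_inf

theorem graphRealize_sup (φ ψ : Language.graph.Formula α) :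
    GraphRealize G (φ ⊔ ψ) v ↔ GraphRealize G φ v ∨ GraphRealize G ψ v := by
  let _ := G.structure
  exact Formula.realize_sup

theorem graphRealize_not (φ : Language.graph.Formula α) :
    GraphRealize G φ.not v ↔ ¬ GraphRealize G φ v := by
  let _ := G.structure
  exact Formula.realize_not

theorem graphRealize_imp (φ ψ : Language.graph.Formula α) :
    GraphRealize G (φ.imp ψ) v ↔ (GraphRealize G φ v → GraphRealize G ψ v) := by
  let _ := G.structure
  exact Formula.realize_imp

theorem graphRealize_iSup {β : Type*} [Finite β] (f : β → Language.graph.Formula α) :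
    GraphRealize G (Formula.iSup f) v ↔ ∃ b, GraphRealize G (f b) v := by
  let _ := G.structure
  exact Formula.realize_iSup

theorem graphRealize_iInf {β : Type*} [Finite β] (f : β → Language.graph.Formula α) :
    GraphRealize G (Formula.iInf f) v ↔ ∀ b, GraphRealize G (f b) v := by
  let _ := G.structure
  exact Formula.realize_iInf

theorem graphRealize_iExs {β : Type*} [Finite β] (φ : Language.graph.Formula (α ⊕ β)) :
    GraphRealize G (φ.iExs β) v ↔ ∃ i : β → V, GraphRealize G φ (Sum.elim v i) := by
  let _ := G.structure
  exact Formula.realize_iExs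

theorem graphRealize_iAlls {β : Type*} [Finite β] (φ : Language.graph.Formula (α ⊕ β)) :
    GraphRealize G (φ.iAlls β) v ↔ ∀ i : β → V, GraphRealize G φ (Sum.elim v i) := by
  let _ := G.structure
  exact Formula.realize_iAlls

theorem graphRealize_memF {n : ℕ} (a : α) (d : Fin n → α) (σ : Set (Fin n)) :
    GraphRealize G (memF a d σ) v ↔ v a ∈ (v ∘ d) '' σ := by
  simp only [memF, graphRealize_iSup, graphRealize_eqF]
  constructor
  · rintro ⟨⟨i, hi⟩, h⟩
    exact ⟨i, hi, h.symm⟩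
  · rintro ⟨i, hi, h⟩
    exact ⟨⟨i, hi⟩, h.symm⟩

/-- Consecutive members of the sequence are equal or adjacent. -/
def IsWalkSeq {n : ℕ} (w : Fin (n + 1) → V) : Prop :=
  ∀ i : Fin n, w i.castSucc = w i.succ ∨ G.Adj (w i.castSucc) (w i.succ)

theorem graphRealize_walkF {n : ℕ} (w : Fin (n + 1) → α) :
    GraphRealize G (walkF w) v ↔ IsWalkSeq G (v ∘ w) := by
  simp only [walkF, graphRealize_iInf, graphRealize_sup, graphRealize_eqF, graphRealize_adjF]
  rfl

/-- The distance of `a` and `b` is at most `n`. -/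
def DistLE (n : ℕ) (a b : V) : Prop :=
  ∃ w : Fin (n + 1) → V, IsWalkSeq G w ∧ a = w 0 ∧ b = w (Fin.last n)

theorem graphRealize_distLEF (n : ℕ) (a b : α) :
    GraphRealize G (distLEF n a b) v ↔ DistLE G n (v a) (v b) := by
  simp only [distLEF, graphRealize_iExs, graphRealize_inf, graphRealize_eqF, graphRealize_walkF,
    and_assoc]
  rfl

theorem graphRealize_distPatternF {k : ℕ} (L : ℕ) (δ : Term2 k → Term2 k → Prop)
    (x : Term2 k → α) : GraphRealize G (distPatternF L δ x) v ↔
      ∀ a b, δ a b ↔ DistLE G L (v (x a)) (v (x b)) := by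
  simp only [distPatternF, graphRealize_inf, graphRealize_iInf, graphRealize_not,
    graphRealize_distLEF]
  constructor
  · rintro ⟨h1, h2⟩ a b
    exact ⟨fun h => h1 ⟨(a, b), h⟩, fun h => by_contra fun h' => h2 ⟨(a, b), h'⟩ h⟩
  · intro h
    exact ⟨fun e => (h _ _).1 e.2, fun e h' => e.2 ((h _ _).2 h')⟩

theorem graphRealize_sepF {k L : ℕ} (x : Term2 k → α) (C : Set (Term2 k)) (d : Fin L → α)
    (σ : Set (Fin L)) : GraphRealize G (sepF x C d σ) v ↔
      IsCut G (v ∘ x '' C) (Set.range (v ∘ d)) (v ∘ d '' σ) := by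
  simp only [sepF, graphRealize_inf, graphRealize_iInf, graphRealize_iAlls, graphRealize_imp,
    graphRealize_sup, graphRealize_memF, graphRealize_adjF, Set.image_univ]
  constructor
  · rintro ⟨h1, h2⟩
    refine ⟨Set.image_subset_range _ _, ?_, ?_⟩
    · rintro _ ⟨a, ha, rfl⟩
      exact h1 ⟨a, ha⟩
    · rintro _ ⟨l, rfl⟩ hl z hz
      exact (h2 (fun _ => z) l hz).resolve_left hl
  · intro h
    refine ⟨fun a => h.cover ⟨a, a.2, rfl⟩, fun z l hz => ?_⟩
    by_cases hl : v (d l) ∈ v ∘ d '' σ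
    · exact Or.inl hl
    · exact Or.inr (h.closed _ ⟨l, rfl⟩ hl _ hz)

theorem wt_eq [Finite V] (T S : Set V) {k : ℕ} (hk : 1 ≤ k) :
    wt T k S = k * (S ∩ T).ncard + (S \ T).ncard := by
  have h : copies T k S = (S ∩ T) ×ˢ (Set.univ : Set (Fin k)) ∪ (S \ T) ×ˢ {⟨0, hk⟩} := by
    ext ⟨a, c⟩
    simp only [copies, Set.mem_ofPred_eq, Set.mem_union, Set.mem_prod, Set.mem_inter_iff,
      Set.mem_univ, Set.mem_sdiff, Set.mem_singleton_iff, Fin.ext_iff]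
    tauto
  rw [wt, h, Set.ncard_union_eq _ (Set.toFinite _) (Set.toFinite _), Set.ncard_prod,
    Set.ncard_prod]
  · simp [mul_comm]
  · rw [Set.disjoint_left]
    rintro ⟨a, c⟩ ⟨h1, -⟩ ⟨h2, -⟩
    exact h2.2 h1.2

theorem graphRealize_weightLEF [Finite V] {k L : ℕ} (hk : 1 ≤ k) (x : Term2 k → α)
    (d : Fin L → α) (σ : Set (Fin L)) (n : ℕ) : GraphRealize G (weightLEF x d σ n) v ↔
      wt (Set.range (v ∘ x)) k (v ∘ d '' σ) ≤ n := by
  simp only [weightLEF, graphRealize_inf, graphRealize_iInf, graphRealize_iSup,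
    graphRealize_sup, graphRealize_memF, graphRealize_not, graphRealize_eqF]
  rw [wt_eq _ _ hk]
  set T := Set.range (v ∘ x) with hT
  set S := v ∘ d '' σ with hS
  have hTiff : ∀ u, (∃ b, u = v (x b)) ↔ u ∈ T := fun u =>
    ⟨fun ⟨b, h⟩ => ⟨b, h.symm⟩, fun ⟨b, h⟩ => ⟨b, h.symm⟩⟩
  constructor
  · rintro ⟨⟨⟨τ₁, τ₀⟩, hτ⟩, h⟩
    simp only [hTiff] at h hτ
    have h1 : S ∩ T ⊆ v ∘ d '' τ₁ := by
      rintro _ ⟨⟨l, hl, rfl⟩, hlT⟩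
      exact (h ⟨l, hl⟩).resolve_right fun h' => h'.2 hlT
    have h2 : S ⊆ v ∘ d '' τ₁ ∪ ((v ∘ d '' τ₀) \ T) := by
      rintro _ ⟨l, hl, rfl⟩
      exact h ⟨l, hl⟩
    -- The part `τ₁` may also cover non-terminals. This only overestimates the weight, as each of
    -- its members is charged `k ≥ 1`.
    have h2' : S \ T ⊆ (v ∘ d '' τ₁) \ (S ∩ T) ∪ v ∘ d '' τ₀ := by
      rintro u ⟨hu, huT⟩
      rcases h2 hu with h' | h'
      · exact Or.inl ⟨h', fun e => huT e.2⟩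
      · exact Or.inr h'.1
    have h3 := (Set.ncard_le_ncard h2' (Set.toFinite _)).trans (Set.ncard_union_le _ _)
    have h4 := Set.ncard_sdiff_add_ncard_of_subset h1 (Set.toFinite _)
    have h5 := Set.ncard_image_le (f := v ∘ d) (Set.toFinite τ₁)
    have h6 := Set.ncard_image_le (f := v ∘ d) (Set.toFinite τ₀)
    nlinarith [Nat.le_mul_of_pos_left ((v ∘ d '' τ₁) \ (S ∩ T)).ncard hk,
      Nat.mul_le_mul_left k (h4.le.trans h5), Nat.mul_le_mul_left k h4.le]
  · intro h
    have key : ∀ R ⊆ S, ∃ τ : Set (Fin L), v ∘ d '' τ = R ∧ τ.ncard = R.ncard := by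
      intro R hR
      obtain ⟨τ, h1, h2⟩ := Set.exists_image_eq_injOn_of_subset_range
        (hR.trans (Set.image_subset_range (v ∘ d) σ))
      exact ⟨τ, h1, by rw [← h1, h2.ncard_image]⟩
    obtain ⟨τ₁, h1, h1'⟩ := key (S ∩ T) Set.inter_subset_left
    obtain ⟨τ₀, h0, h0'⟩ := key (S \ T) Set.sdiff_subset
    refine ⟨⟨(τ₁, τ₀), by simpa only [h1', h0'] using h⟩, fun l => ?_⟩
    simp only [hTiff, h1, h0]
    have hl : v (d l) ∈ S := ⟨l, l.2, rfl⟩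
    by_cases hlT : v (d l) ∈ T
    · exact Or.inl ⟨hl, hlT⟩
    · exact Or.inr ⟨⟨hl, hlT⟩, hlT⟩

theorem wt_image_le {L k : ℕ} [Finite V] (hk : 1 ≤ k) (T : Set V) (d : Fin L → V)
    (σ : Set (Fin L)) : wt T k (d '' σ) ≤ k * L := by
  rw [wt_eq _ _ hk]
  have h1 := Set.ncard_inter_add_ncard_sdiff_eq_ncard (d '' σ) T (Set.toFinite _)
  have h2 := Set.ncard_image_le (f := d) (Set.toFinite σ)
  have h3 := Set.ncard_le_card σ
  rw [Nat.card_fin] at h3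
  nlinarith [Nat.le_mul_of_pos_left ((d '' σ) \ T).ncard hk,
    Nat.mul_le_mul_left k (h1.le.trans (h2.trans h3)), Nat.mul_le_mul_left k h1.ge]

theorem graphRealize_minSepF [Finite V] {k L : ℕ} (hk : 1 ≤ k) (x : Term2 k → α)
    (C : Set (Term2 k)) (d : Fin L → α) (σ : Set (Fin L)) :
    GraphRealize G (minSepF x C d σ) v ↔
      IsCut G (v ∘ x '' C) (Set.range (v ∘ d)) (v ∘ d '' σ) ∧
      ∀ (d' : Fin L → V) (σ' : Set (Fin L)), IsCut G (v ∘ x '' C) (Set.range d') (d' '' σ') →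
        wt (Set.range (v ∘ x)) k (v ∘ d '' σ) ≤ wt (Set.range (v ∘ x)) k (d' '' σ') := by
  simp only [minSepF, graphRealize_inf, graphRealize_iInf, graphRealize_iAlls, graphRealize_imp,
    graphRealize_sepF, graphRealize_weightLEF _ _ hk]
  refine and_congr Iff.rfl (forall_congr' fun d' => forall_congr' fun σ' => ?_)
  change (IsCut G (v ∘ x '' C) (Set.range d') (d' '' σ') → ∀ n : Fin (k * L + 1),
    wt (Set.range (v ∘ x)) k (d' '' σ') ≤ n → wt (Set.range (v ∘ x)) k (v ∘ d '' σ) ≤ n) ↔ _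
  refine imp_congr Iff.rfl ⟨fun h => ?_, fun h n hn => h.trans hn⟩
  -- Comparing with every bound up to `k * L` compares the weights: the bound is taken to be the
  -- weight of the competitor itself.
  exact h ⟨_, Nat.lt_succ_of_le (wt_image_le hk _ d' σ')⟩ le_rfl

/-- The semantic content of `linkF`. -/
structure IsLink {k L : ℕ} {δ : Term2 k → Term2 k → Prop} (x : Term2 k → V)
    (d : Cluster δ → Fin L → V) (σ : Cluster δ → Set (Fin L))
    (w : Term2 k → Fin (L + 1) → V) : Prop where
  walk : ∀ a, IsWalkSeq G (w a)
  start : ∀ a, x a = w a 0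
  mem : ∀ a l, w a l ∈ Set.range (d (Quotient.mk _ a))
  ends : ∀ i, w (.inl i) (Fin.last L) = w (.inr i) (Fin.last L) ∨
    (w (.inl i) (Fin.last L) ∈ d (Quotient.mk _ (.inl i)) '' σ (Quotient.mk _ (.inl i)) ∧
      w (.inr i) (Fin.last L) ∈ d (Quotient.mk _ (.inr i)) '' σ (Quotient.mk _ (.inr i)))
  disj : ∀ a b, pairIndex a ≠ pairIndex b → ∀ l m, w a l = w b m →
    (w a l = x (.inl (pairIndex a)) ∨ w a l = x (.inr (pairIndex a))) ∧
    (w a l = x (.inl (pairIndex b)) ∨ w a l = x (.inr (pairIndex b)))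

theorem graphRealize_linkF {k L : ℕ} {δ : Term2 k → Term2 k → Prop} (x : Term2 k → α)
    (d : Cluster δ → Fin L → α) (σ : Cluster δ → Set (Fin L))
    (w : Term2 k → Fin (L + 1) → α) : GraphRealize G (linkF x d σ w) v ↔
      IsLink G (v ∘ x) (fun c => v ∘ d c) σ (fun a => v ∘ w a) := by
  simp only [linkF, graphRealize_inf, graphRealize_iInf, graphRealize_imp, graphRealize_sup,
    graphRealize_memF, graphRealize_eqF, graphRealize_walkF, Set.image_univ]
  constructor
  · rintro ⟨⟨h1, h2⟩, h3⟩
    refine ⟨fun a => (h1 a).1.1, fun a => (h1 a).1.2, fun a => (h1 a).2, h2, ?_⟩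
    intro a b hab l m hlm
    refine h3 ⟨(pairIndex a, pairIndex b), hab⟩ ⟨a, ?_⟩ ⟨b, ?_⟩ (l, m) hlm
    · rcases a with i | i
      exacts [Or.inl rfl, Or.inr rfl]
    · rcases b with i | i
      exacts [Or.inl rfl, Or.inr rfl]
  · intro h
    refine ⟨⟨fun a => ⟨⟨h.walk a, h.start a⟩, h.mem a⟩, h.ends⟩, ?_⟩
    rintro ⟨⟨i, j⟩, hij⟩ ⟨a, ha⟩ ⟨b, hb⟩ ⟨l, m⟩ hlm
    have hia : pairIndex a = i := by rcases ha with rfl | rfl <;> rfl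
    have hjb : pairIndex b = j := by rcases hb with rfl | rfl <;> rfl
    subst hia hjb
    exact h.disj a b hij l m hlm

theorem graphRealize_dpFormula [Finite V] {k L : ℕ} (hk : 1 ≤ k) (x : Term2 k → V) :
    GraphRealize G (dpFormula k L) x ↔
      ∃ (σ : Cluster (fun a b => DistLE G L (x a) (x b)) → Set (Fin L)) (d : _ → Fin L → V)
        (w : Term2 k → Fin (L + 1) → V),
        (∀ c, IsCut G (x '' c.terminals) (Set.range (d c)) (d c '' σ c) ∧
          ∀ (d' : Fin L → V) (σ' : Set (Fin L)),
            IsCut G (x '' c.terminals) (Set.range d') (d' '' σ') →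
            wt (Set.range x) k (d c '' σ c) ≤ wt (Set.range x) k (d' '' σ')) ∧
        IsLink G x d σ w := by
  simp only [dpFormula, graphRealize_inf, graphRealize_iInf, graphRealize_iSup, graphRealize_iExs,
    graphRealize_linkF, graphRealize_minSepF _ _ hk, graphRealize_distPatternF]
  constructor
  · rintro ⟨δ, hδ, σ, f, h1, h2⟩
    obtain rfl : δ = fun a b => DistLE G L (x a) (x b) := by
      ext a b
      exact hδ a b
    exact ⟨σ, fun c l => f (.inl (c, l)), fun a l => f (.inr (a, l)), h1, h2⟩
  · rintro ⟨σ, d, w, h1, h2⟩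
    exact ⟨_, fun _ _ => Iff.rfl, σ, Sum.elim (fun c => d c.1 c.2) (fun a => w a.1 a.2), h1, h2⟩

end Semantics

/-! ## From the formula to disjoint paths -/

section Backward

variable {V : Type*}

theorem IsWalkSeq.connOn {G : SimpleGraph V} {n : ℕ} {w : Fin (n + 1) → V} (h : IsWalkSeq G w) :
    ConnOn G (Set.range w) := by
  refine ⟨⟨w 0, 0, rfl⟩, ?_⟩
  rintro T hT ⟨a, ha⟩ ⟨b, ⟨j, rfl⟩, hb⟩
  obtain ⟨i, rfl⟩ := hT ha
  by_contra hcon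
  push Not at hcon
  have key : ∀ l, w l ∈ T ↔ w 0 ∈ T := by
    intro l
    induction l using Fin.induction with
    | zero => rfl
    | succ l ih =>
      rw [← ih]
      rcases h l with h | h
      · rw [h]
      · constructor
        · intro h1
          by_contra h2
          exact hcon _ h1 _ ⟨⟨_, rfl⟩, h2⟩ h.symm
        · intro h1
          by_contra h2
          exact hcon _ h1 _ ⟨⟨_, rfl⟩, h2⟩ h
  exact hb ((key j).2 ((key i).1 ha))

/-- A walk inside a set of at most `n` vertices yields a short sequence of steps. -/
theorem exists_isWalkSeq [Finite V] {G : SimpleGraph V} {a b : V} (p : G.Walk a b) {D : Set V}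
    (hp : ∀ v ∈ p.support, v ∈ D) {n : ℕ} (hD : D.ncard ≤ n) :
    ∃ w : Fin (n + 1) → V, IsWalkSeq G w ∧ w 0 = a ∧ w (Fin.last n) = b ∧
      ∀ l, w l ∈ p.support := by
  classical
  let q := p.bypass
  have hlen : q.length ≤ n := by
    have h1 : q.support.toFinset.card ≤ D.ncard := by
      rw [← Set.ncard_coe_finset]
      refine Set.ncard_le_ncard (fun v hv => hp v ?_) (Set.toFinite _)
      exact p.support_bypass_subset_support (by simpa using hv)
    rw [List.toFinset_card_of_nodup p.bypass_isPath.support_nodup,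
      SimpleGraph.Walk.length_support] at h1
    exact (Nat.le_succ _).trans (h1.trans hD)
  -- Beyond its length the path stays at its end, which pads the sequence to exactly `n` steps.
  refine ⟨fun l => q.getVert l, fun i => ?_, q.getVert_zero, ?_, fun l => ?_⟩
  · by_cases hi : (i : ℕ) < q.length
    · exact Or.inr (q.adj_getVert_succ hi)
    · left
      simp only [Fin.val_castSucc, Fin.val_succ]
      rw [q.getVert_of_length_le (by omega), q.getVert_of_length_le (by omega)]
  · exact q.getVert_of_length_le hlen
  · exact p.support_bypass_subset_support (q.getVert_mem_support l)

theorem exists_range_eq [Finite V] {D : Set V} (hD : D.Nonempty) {n : ℕ} (h : D.ncard ≤ n) :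
    ∃ d : Fin n → V, Set.range d = D := by
  have := hD.to_subtype
  have := Fintype.ofFinite D
  obtain ⟨f⟩ := Function.Embedding.nonempty_of_card_le (α := D) (β := Fin n) (by
    rwa [Fintype.card_fin, ← Nat.card_eq_fintype_card, Nat.card_coe_set_eq])
  obtain ⟨g, hg⟩ := f.injective.hasLeftInverse.imp fun g hg => hg.surjective
  refine ⟨fun i => g i, ?_⟩
  ext v
  constructor
  · rintro ⟨i, rfl⟩
    exact (g i).2
  · intro hv
    obtain ⟨i, hi⟩ := hg ⟨v, hv⟩
    exact ⟨i, congrArg Subtype.val hi⟩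

theorem wt_iUnion_le [Finite V] {ι : Type*} [Fintype ι] (T : Set V) (k : ℕ) (S : ι → Set V) :
    wt T k (⋃ i, S i) ≤ ∑ i, wt T k (S i) := by
  have : copies T k (⋃ i, S i) = ⋃ i, copies T k (S i) := by
    ext q
    simp [copies]
  rw [wt, this]
  exact Set.ncard_iUnion_le_of_fintype _

theorem sum_wt_le [Finite V] {ι : Type*} [Fintype ι] (T : Set V) (k : ℕ) (S : ι → Set V)
    {S' : Set V} (hS : ∀ i, S i ⊆ S') (hd : Pairwise (Function.onFun Disjoint S)) :
    ∑ i, wt T k (S i) ≤ wt T k S' := by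
  classical
  have hd' : Pairwise (Function.onFun Disjoint fun i => copies T k (S i)) := by
    intro i j hij
    rw [Function.onFun, Set.disjoint_left]
    exact fun q hq hq' => Set.disjoint_left.1 (hd hij) hq.1 hq'.1
  have h1 : ∀ s : Finset ι, (⋃ i ∈ s, copies T k (S i)).ncard = ∑ i ∈ s, wt T k (S i) := by
    intro s
    induction s using Finset.induction_on with
    | empty => simp
    | insert i s hi ih =>
      rw [Finset.set_biUnion_insert, Finset.sum_insert hi, Set.ncard_union_eq _ (Set.toFinite _)
        (Set.toFinite _), ih, wt]
      rw [Set.disjoint_iUnion₂_right]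
      exact fun j hj => hd' fun e => hi (e ▸ hj)
  rw [← h1]
  refine Set.ncard_le_ncard (fun q hq => ?_) (Set.toFinite _)
  simp only [Set.mem_iUnion] at hq
  obtain ⟨i, -, hq⟩ := hq
  exact ⟨hS i hq.1, hq.2⟩

theorem wt_self_le [Finite V] {k : ℕ} (hk : 1 ≤ k) (x : Term2 k → V) :
    (Set.range x).ncard ≤ 2 * k ∧ wt (Set.range x) k (Set.range x) ≤ 2 * k ^ 2 := by
  have h1 : (Set.range x).ncard ≤ 2 * k := by
    rw [← Set.image_univ]
    refine (Set.ncard_image_le (Set.toFinite _)).trans ?_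
    rw [Set.ncard_univ, Nat.card_sum, Nat.card_fin]
    omega
  refine ⟨h1, ?_⟩
  rw [wt_eq _ _ hk, Set.inter_self, Set.sdiff_self, Set.ncard_empty]
  nlinarith [Nat.mul_le_mul_left k h1]

/-- The `t` disjoint branch sets force more than `L` vertices. A set `A` of `p` vertices against the
whole graph is a separation of order `p`, so its small side must be `A`, whence `p ≤ L`. -/
theorem IsUnbreakable.le_of_isModel [Finite V] {G : SimpleGraph V} {k L p t : ℕ} (hk : 1 ≤ k)
    (hp : p = 4 * k ^ 3) (ht : t = max (6 * k ^ 3) (2 * k * L)) (hG : IsUnbreakable G L p)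
    {B : Fin t → Set V} (hB : IsModel G B) : L < t ∧ p ≤ L := by
  have hk3 : 1 ≤ k ^ 3 := Nat.one_le_pow _ _ hk
  have h1 : 6 * k ^ 3 ≤ t := ht ▸ le_max_left _ _
  have h2 : 2 * k * L ≤ t := ht ▸ le_max_right _ _
  have hLt : L < t := by nlinarith
  refine ⟨hLt, ?_⟩
  have h3 : t ≤ (Set.univ : Set V).ncard := by
    have h := ncard_meet_le hB.disj Set.univ
    rw [show {i | ¬ Disjoint (B i) Set.univ} = Set.univ from Set.eq_univ_of_forall fun i => by
      simpa [Set.nonempty_iff_ne_empty] using (hB.conn i).1, Set.ncard_univ, Nat.card_fin] at h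
    exact h
  obtain ⟨A, -, hA⟩ := Set.exists_subset_card_eq (show p ≤ (Set.univ : Set V).ncard by omega)
  have := hG ((⊤ : G.Subgraph).induce A) ⊤ ⟨by simp, fun u hu => absurd trivial hu.2⟩
    (by simpa using hA.le)
  simp only [SimpleGraph.Subgraph.induce_verts, SimpleGraph.Subgraph.verts_top,
    Set.inter_univ] at this
  omega

/-- The union of the cluster data satisfies the hypotheses of `DP.of_isCut`; the main point is that
its separator has minimum weight for all terminals together. -/
theorem DP.of_isLink [Finite V] {G : SimpleGraph V} {k L p t : ℕ} (hk : 1 ≤ k)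
    (hp : p = 4 * k ^ 3) (ht : t = max (6 * k ^ 3) (2 * k * L)) (hG : IsUnbreakable G L p)
    {B : Fin t → Set V} (hB : IsModel G B) (x : Term2 k → V)
    (σ : Cluster (fun a b => DistLE G L (x a) (x b)) → Set (Fin L)) (d : _ → Fin L → V)
    (w : Term2 k → Fin (L + 1) → V)
    (hcut : ∀ c, IsCut G (x '' c.terminals) (Set.range (d c)) (d c '' σ c) ∧
      ∀ (d' : Fin L → V) (σ' : Set (Fin L)),
        IsCut G (x '' c.terminals) (Set.range d') (d' '' σ') →
        wt (Set.range x) k (d c '' σ c) ≤ wt (Set.range x) k (d' '' σ'))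
    (hw : IsLink G x d σ w) : DP G (fun i => x (.inl i)) (fun i => x (.inr i)) := by
  classical
  obtain ⟨hLt, hpL⟩ := hG.le_of_isModel hk hp ht hB
  have hk2 : 1 ≤ k ^ 2 := Nat.one_le_pow _ _ hk
  have hk3 : k ^ 2 ≤ k ^ 3 := Nat.pow_le_pow_right hk (by norm_num)
  have hkk : k ≤ k ^ 3 := Nat.le_self_pow (by norm_num) k
  have h6 : 6 * k ^ 3 ≤ t := ht ▸ le_max_left _ _
  have : Fintype (Cluster fun a b => DistLE G L (x a) (x b)) := Fintype.ofFinite _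
  have hmin : ∀ D' S', IsCut G (Set.range x) D' S' → D'.ncard ≤ L →
      wt (Set.range x) k (⋃ c, d c '' σ c) ≤ wt (Set.range x) k S' := by
    intro D' S' h hL
    -- The part of `D'` reachable inside `D'` from the terminals of one cluster. Two such parts are
    -- disjoint, since a walk within `D'` shortens to length at most `L`.
    let D₁ : (Cluster fun a b => DistLE G L (x a) (x b)) → Set V := fun c =>
      {v | ∃ a, Quotient.mk _ a = c ∧ ∃ p : G.Walk (x a) v, ∀ u ∈ p.support, u ∈ D'}
    have hD₁ : ∀ c, D₁ c ⊆ D' := fun c v ⟨a, _, p, hp⟩ => hp v p.end_mem_support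
    have hx : ∀ a, x a ∈ D₁ (Quotient.mk _ a) := fun a =>
      ⟨a, rfl, .nil, by simpa using h.cover ⟨a, rfl⟩⟩
    have hcut₁ : ∀ c, IsCut G (x '' c.terminals) (D₁ c) (S' ∩ D₁ c) := by
      intro c
      refine ⟨Set.inter_subset_right, ?_, ?_⟩
      · rintro _ ⟨a, rfl, rfl⟩
        exact hx a
      · intro v hv hvS z hvz
        have hz : z ∈ D' := h.closed v (hD₁ c hv) (fun hS => hvS ⟨hS, hv⟩) z hvz
        obtain ⟨a, ha, p, hp⟩ := hv
        refine ⟨a, ha, p.concat hvz, fun u hu => ?_⟩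
        rcases (by simpa using hu : u ∈ p.support ∨ u = z) with hu | rfl
        · exact hp u hu
        · exact hz
    have hdisj : Pairwise (Function.onFun Disjoint fun c => S' ∩ D₁ c) := by
      intro c c' hcc
      rw [Function.onFun, Set.disjoint_left]
      rintro v ⟨-, a, rfl, p, hp⟩ ⟨-, b, rfl, q, hq⟩
      refine hcc (Quotient.sound (Relation.EqvGen.rel _ _ ?_))
      obtain ⟨w, hw, h0, h1, -⟩ := exists_isWalkSeq (p.append q.reverse) (D := D') (by
        intro u hu
        rcases (SimpleGraph.Walk.mem_support_append_iff _ _).1 hu with hu | hu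
        · exact hp u hu
        · exact hq u (by simpa using hu)) hL
      exact ⟨w, hw, h0.symm, h1.symm⟩
    refine (wt_iUnion_le _ _ _).trans (le_trans ?_
      (sum_wt_le _ _ (fun c => S' ∩ D₁ c) (fun c => Set.inter_subset_left) hdisj))
    refine Finset.sum_le_sum fun c _ => ?_
    obtain ⟨a, rfl⟩ := Quotient.exists_rep c
    obtain ⟨d', hd'⟩ := exists_range_eq ⟨x a, hx a⟩
      ((Set.ncard_le_ncard (hD₁ (Quotient.mk _ a)) (Set.toFinite _)).trans hL)
    have himg : d' '' (d' ⁻¹' (S' ∩ D₁ (Quotient.mk _ a))) = S' ∩ D₁ (Quotient.mk _ a) := by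
      rw [Set.image_preimage_eq_inter_range, hd']
      exact Set.inter_eq_left.2 Set.inter_subset_right
    have := (hcut (Quotient.mk _ a)).2 d' (d' ⁻¹' (S' ∩ D₁ (Quotient.mk _ a)))
    rw [himg, hd'] at this
    exact this (hcut₁ _)
  have hcutU : IsCut G (Set.range x) (⋃ c, Set.range (d c)) (⋃ c, d c '' σ c) := by
    refine ⟨Set.iUnion_mono fun c => (hcut c).1.sub, ?_, ?_⟩
    · rintro _ ⟨a, rfl⟩
      exact Set.mem_iUnion.2 ⟨Quotient.mk _ a, (hcut _).1.cover ⟨a, rfl, rfl⟩⟩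
    · intro v hv hvS z hvz
      obtain ⟨c, hc⟩ := Set.mem_iUnion.1 hv
      exact Set.mem_iUnion.2 ⟨c, (hcut c).1.closed v hc
        (fun h => hvS (Set.mem_iUnion.2 ⟨c, h⟩)) z hvz⟩
  obtain ⟨hT1, hT2⟩ := wt_self_le hk x
  -- The terminals alone, as both part and separator, are a competitor: at most `2k` vertices of
  -- weight `k`.
  have hwt : wt (Set.range x) k (⋃ c, d c '' σ c) ≤ 2 * k ^ 2 :=
    (hmin _ _ ⟨subset_rfl, subset_rfl, fun v hv hv' => absurd hv hv'⟩ (by omega)).trans hT2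
  refine DP.of_isCut hk hG hB hLt x hcutU hmin (by omega) (by omega) ?_
    (fun a => Set.range (w a)) (fun a => w a (Fin.last L)) ?_ ?_ ?_
  -- A branch set avoiding the separators but meeting some `D_c` lies inside `D_c \ S_c`. All `t`
  -- branch sets then meet `D_c`, which has at most `L < t` vertices.
  · intro i hi
    by_contra hcon
    obtain ⟨v, hv, hvD⟩ := Set.not_disjoint_iff.1 hcon
    obtain ⟨c, hc⟩ := Set.mem_iUnion.1 hvD
    have hS : ∀ u ∈ B i, u ∉ d c '' σ c := fun u hu h =>
      Set.disjoint_left.1 hi hu (Set.mem_iUnion.2 ⟨c, h⟩)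
    have hsub : B i ⊆ Set.range (d c) \ (d c '' σ c) :=
      (hB.conn i).subset_of_closed hv ⟨hc, hS v hv⟩ fun a b ha hab hb =>
        ⟨(hcut c).1.closed a ha.1 ha.2 b hab, hS b hb⟩
    have hmeet : ∀ j, ¬ Disjoint (B j) (Set.range (d c)) := by
      intro j
      rw [Set.not_disjoint_iff]
      by_cases hij : i = j
      · exact ⟨v, hij ▸ hv, hc⟩
      · obtain ⟨a, ha, b, hb, hab⟩ := hB.adj i j hij
        exact ⟨b, hb, (hcut c).1.closed a (hsub ha).1 (hsub ha).2 b hab⟩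
    have h1 := ncard_meet_le hB.disj (Set.range (d c))
    rw [show {j | ¬ Disjoint (B j) (Set.range (d c))} = Set.univ from Set.eq_univ_of_forall hmeet,
      Set.ncard_univ, Nat.card_fin, ← Set.image_univ] at h1
    have h2 := Set.ncard_image_le (f := d c) (s := Set.univ) (Set.toFinite _)
    rw [Set.ncard_univ, Nat.card_fin] at h2
    omega
  · intro a
    refine ⟨(hw.walk a).connOn, ⟨0, (hw.start a).symm⟩, ⟨_, rfl⟩, ?_⟩
    rintro _ ⟨l, rfl⟩
    exact Set.mem_iUnion.2 ⟨_, hw.mem a l⟩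
  · intro i
    refine (hw.ends i).imp_right fun h => ?_
    exact ⟨Set.mem_iUnion.2 ⟨_, h.1⟩, Set.mem_iUnion.2 ⟨_, h.2⟩⟩
  · rintro a b hab _ ⟨l, rfl⟩ ⟨m, hm⟩
    exact (hw.disj a b hab l m hm.symm).1

end Backward

/-! ## From disjoint paths to the formula -/

section Forward

variable {V : Type*}

theorem exists_min_cut [Finite V] (G : SimpleGraph V) (T₀ T : Set V) (k : ℕ) {L : ℕ}
    (hT₀ : T₀.Nonempty) (hL : T₀.ncard ≤ L) :
    ∃ (d : Fin L → V) (σ : Set (Fin L)), IsCut G T₀ (Set.range d) (d '' σ) ∧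
      ∀ (d' : Fin L → V) (σ' : Set (Fin L)), IsCut G T₀ (Set.range d') (d' '' σ') →
        wt T k (d '' σ) ≤ wt T k (d' '' σ') := by
  obtain ⟨d₀, hd₀⟩ := exists_range_eq hT₀ hL
  let C : Set ((Fin L → V) × Set (Fin L)) := {q | IsCut G T₀ (Set.range q.1) (q.1 '' q.2)}
  have hC : C.Nonempty := by
    refine ⟨(d₀, Set.univ), ?_⟩
    change IsCut G T₀ (Set.range d₀) (d₀ '' Set.univ)
    rw [Set.image_univ, hd₀]
    exact ⟨subset_rfl, subset_rfl, fun v hv hv' => absurd hv hv'⟩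
  obtain ⟨q, hq, hmin⟩ := Set.exists_min_image C (fun q => wt T k (q.1 '' q.2)) (Set.toFinite _) hC
  exact ⟨q.1, q.2, hq, fun d' σ' h => hmin (d', σ') h⟩

/-- A walk starting in `D` either reaches the separator `S` inside `D` or never leaves `D`. -/
theorem IsCut.exists_walk {G : SimpleGraph V} {T D S : Set V} (h : IsCut G T D S) {u v : V}
    (p : G.Walk u v) (hu : u ∈ D) :
    (∃ s ∈ S, ∃ q : G.Walk u s, ∀ w ∈ q.support, w ∈ p.support ∧ w ∈ D) ∨
      ∀ w ∈ p.support, w ∈ D := by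
  induction p with
  | nil => exact Or.inr (by simpa using hu)
  | @cons a b c hab p ih =>
    by_cases haS : a ∈ S
    · exact Or.inl ⟨a, haS, .nil, by simpa using hu⟩
    · refine (ih (h.closed a hu haS b hab)).imp ?_ ?_
      · rintro ⟨s, hs, q, hq⟩
        refine ⟨s, hs, .cons hab q, fun w hw => ?_⟩
        rw [SimpleGraph.Walk.support_cons, List.mem_cons] at hw ⊢
        rcases hw with rfl | hw
        · exact ⟨Or.inl rfl, hu⟩
        · exact ⟨Or.inr (hq w hw).1, (hq w hw).2⟩
      · intro hp w hw
        rw [SimpleGraph.Walk.support_cons, List.mem_cons] at hw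
        rcases hw with rfl | hw
        · exact hu
        · exact hp w hw

/-- Any choice of minimum cuts works: each path is followed from both ends up to the separators, and
walks within the supports of the given paths inherit their disjointness. -/
theorem DP.exists_isLink [Finite V] {G : SimpleGraph V} {k L : ℕ} (hkL : 2 * k ≤ L)
    (x : Term2 k → V) (hDP : DP G (fun i => x (.inl i)) (fun i => x (.inr i))) :
    ∃ (σ : Cluster (fun a b => DistLE G L (x a) (x b)) → Set (Fin L)) (d : _ → Fin L → V)
      (w : Term2 k → Fin (L + 1) → V),
      (∀ c, IsCut G (x '' c.terminals) (Set.range (d c)) (d c '' σ c) ∧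
        ∀ (d' : Fin L → V) (σ' : Set (Fin L)),
          IsCut G (x '' c.terminals) (Set.range d') (d' '' σ') →
          wt (Set.range x) k (d c '' σ c) ≤ wt (Set.range x) k (d' '' σ')) ∧
      IsLink G x d σ w := by
  have hmin : ∀ c : Cluster (fun a b => DistLE G L (x a) (x b)), ∃ (d : Fin L → V) (σ : Set (Fin L)),
      IsCut G (x '' c.terminals) (Set.range d) (d '' σ) ∧
      ∀ (d' : Fin L → V) (σ' : Set (Fin L)),
        IsCut G (x '' c.terminals) (Set.range d') (d' '' σ') →
        wt (Set.range x) k (d '' σ) ≤ wt (Set.range x) k (d' '' σ') := by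
    intro c
    refine exists_min_cut G _ _ k ?_ ?_
    · obtain ⟨a, rfl⟩ := Quotient.exists_rep c
      exact ⟨x a, a, rfl, rfl⟩
    · refine (Set.ncard_image_le (Set.toFinite _)).trans ((Set.ncard_le_card _).trans ?_)
      rw [Nat.card_sum, Nat.card_fin]
      omega
  choose d σ hcut using hmin
  obtain ⟨P, hP⟩ := hDP
  have hcard : ∀ c, (Set.range (d c)).ncard ≤ L := by
    intro c
    rw [← Set.image_univ]
    refine (Set.ncard_image_le (Set.toFinite _)).trans ?_
    rw [Set.ncard_univ, Nat.card_fin]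
  let D : Term2 k → Set V := fun a => Set.range (d (Quotient.mk _ a))
  let S : Term2 k → Set V := fun a => d (Quotient.mk _ a) '' σ (Quotient.mk _ a)
  have hx : ∀ a, x a ∈ D a := fun a => (hcut _).1.cover ⟨a, rfl, rfl⟩
  have key : ∀ i, ∃ w₁ w₂ : Fin (L + 1) → V, (IsWalkSeq G w₁ ∧ w₁ 0 = x (.inl i) ∧
      ∀ l, w₁ l ∈ D (.inl i) ∧ w₁ l ∈ (P i).1.support) ∧ (IsWalkSeq G w₂ ∧ w₂ 0 = x (.inr i) ∧
      ∀ l, w₂ l ∈ D (.inr i) ∧ w₂ l ∈ (P i).1.support) ∧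
      (w₁ (Fin.last L) = w₂ (Fin.last L) ∨
        (w₁ (Fin.last L) ∈ S (.inl i) ∧ w₂ (Fin.last L) ∈ S (.inr i))) := by
    intro i
    have hsx := (P i).1.start_mem_support
    have hsy := (P i).1.end_mem_support
    rcases (hcut (Quotient.mk _ (.inl i))).1.exists_walk (P i).1 (hx _) with ⟨s, hs, q, hq⟩ | h
    · rcases (hcut (Quotient.mk _ (.inr i))).1.exists_walk (P i).1.reverse (hx _) with
        ⟨s', hs', q', hq'⟩ | h
      · obtain ⟨w₁, h1, h2, h3, h4⟩ := exists_isWalkSeq q (fun w hw => (hq w hw).2) (hcard _)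
        obtain ⟨w₂, g1, g2, g3, g4⟩ := exists_isWalkSeq q' (fun w hw => (hq' w hw).2) (hcard _)
        refine ⟨w₁, w₂, ⟨h1, h2, fun l => ⟨(hq _ (h4 l)).2, (hq _ (h4 l)).1⟩⟩,
          ⟨g1, g2, fun l => ⟨(hq' _ (g4 l)).2, by simpa using (hq' _ (g4 l)).1⟩⟩,
          Or.inr ⟨h3 ▸ hs, g3 ▸ hs'⟩⟩
      · obtain ⟨w₂, g1, g2, g3, g4⟩ := exists_isWalkSeq _ h (hcard _)
        -- The path never leaves the part of `y_i`, so the walk of `y_i` covers all of it and the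
        -- walk of `x_i` stays put.
        exact ⟨fun _ => x (.inl i), w₂, ⟨fun _ => Or.inl rfl, rfl, fun _ => ⟨hx _, hsx⟩⟩,
          ⟨g1, g2, fun l => ⟨h _ (g4 l), by simpa using g4 l⟩⟩, Or.inl g3.symm⟩
    · obtain ⟨w₁, g1, g2, g3, g4⟩ := exists_isWalkSeq _ h (hcard _)
      exact ⟨w₁, fun _ => x (.inr i), ⟨g1, g2, fun l => ⟨h _ (g4 l), g4 l⟩⟩,
        ⟨fun _ => Or.inl rfl, rfl, fun _ => ⟨hx _, hsy⟩⟩, Or.inl g3⟩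
  choose w₁ w₂ h₁ h₂ hend using key
  have hsupp : ∀ a l, Sum.elim w₁ w₂ a l ∈ (P (pairIndex a)).1.support := by
    rintro (i | i) l
    exacts [((h₁ i).2.2 l).2, ((h₂ i).2.2 l).2]
  refine ⟨σ, d, Sum.elim w₁ w₂, hcut, ?_, ?_, ?_, hend, ?_⟩
  · rintro (i | i)
    exacts [(h₁ i).1, (h₂ i).1]
  · rintro (i | i)
    exacts [(h₁ i).2.1.symm, (h₂ i).2.1.symm]
  · rintro (i | i) l
    exacts [((h₁ i).2.2 l).1, ((h₂ i).2.2 l).1]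
  · intro a b hab l m hlm
    have ha := hsupp a l
    have hb := hsupp b m
    rw [← hlm] at hb
    have hd := hP _ _ hab
    constructor
    · by_contra hcon
      push Not at hcon
      exact hd.2 _ hb ⟨ha, hcon.1, hcon.2⟩
    · by_contra hcon
      push Not at hcon
      exact hd.1 _ ha ⟨hb, hcon.1, hcon.2⟩

end Forward

/-- `DP_k` is expressed by `dpFormula k L` in unbreakable graphs with a large clique minor. -/
theorem dp_iff_graphRealize {V : Type*} [Finite V] {G : SimpleGraph V} {k p L t : ℕ}
    (hp : p = 4 * k ^ 3) (ht : t = max (6 * k ^ 3) (2 * k * L)) (hG : IsUnbreakable G L p)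
    (hminor : IsMinor (⊤ : SimpleGraph (Fin t)) G) (x y : Fin k → V) :
    DP G x y ↔ GraphRealize G (dpFormula k L) (Sum.elim x y) := by
  rcases Nat.eq_zero_or_pos k with rfl | hk
  -- For `k = 0` there are no terminals and no clusters, so both sides hold vacuously.
  · refine iff_of_true ⟨fun i => i.elim0, fun i => i.elim0⟩ ?_
    simp only [dpFormula, graphRealize_inf, graphRealize_iInf, graphRealize_iSup,
      graphRealize_iExs, graphRealize_linkF, graphRealize_distPatternF]
    have hT : IsEmpty (Term2 0) := inferInstance
    have hC : IsEmpty (Cluster fun _ _ : Term2 0 => False) :=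
      ⟨fun c => (Quotient.exists_rep c).elim fun a _ => hT.elim a⟩
    refine ⟨fun _ _ => False, fun a => hT.elim a, fun _ => ∅,
      Sum.elim (fun c => hC.elim c.1) (fun a => hT.elim a.1), fun c => hC.elim c, ?_⟩
    exact ⟨fun a => hT.elim a, fun a => hT.elim a, fun a => hT.elim a, fun i => i.elim0,
      fun a => hT.elim a⟩
  · obtain ⟨B, hB⟩ := hminor.exists_isModel
    rw [graphRealize_dpFormula _ hk]
    constructor
    · intro h
      have := (hG.le_of_isModel hk hp ht hB).2
      have hk3 : k ≤ k ^ 3 := Nat.le_self_pow (by norm_num) k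
      exact DP.exists_isLink (by omega) (Sum.elim x y) h
    · rintro ⟨σ, d, w, h1, h2⟩
      exact DP.of_isLink hk hp ht hG hB (Sum.elim x y) σ d w h1 h2

/-! ## Eliminating disjoint-paths atoms -/

section Padding

variable {V : Type*} {G : SimpleGraph V}

theorem exists_path_support_eq {a b a' b' : V} (ha : a = a') (hb : b = b') (P : G.Path a b) :
    ∃ Q : G.Path a' b', Q.1.support = P.1.support := by
  subst ha hb
  exact ⟨P, rfl⟩

/-- The pair used at position `i` when `j` pairs are padded to `k` pairs. -/
def padIndex {j : ℕ} (hj : 1 ≤ j) (i : ℕ) : Fin j := if h : i < j then ⟨i, h⟩ else ⟨0, hj⟩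

/-- A disjoint-paths query with `j` pairs is padded to `k ≥ j` pairs by trivial paths. -/
theorem dp_pad_iff {j k : ℕ} (hj : 1 ≤ j) (hjk : j ≤ k) (s t : Fin j → V) :
    DP G s t ↔ DP G (fun i : Fin k => s (padIndex hj i))
      (fun i : Fin k => if (i : ℕ) < j then t (padIndex hj i) else s (padIndex hj i)) := by
  constructor
  · rintro ⟨P, hP⟩
    have key : ∀ i : Fin k, ∃ Q : G.Path (s (padIndex hj i))
        (if (i : ℕ) < j then t (padIndex hj i) else s (padIndex hj i)),
        (∀ v ∈ Q.1.support, v ∈ (P (padIndex hj i)).1.support) ∧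
        (∀ v, IsInternal Q v → (i : ℕ) < j ∧ IsInternal (P (padIndex hj i)) v) ∧
        (¬ (i : ℕ) < j → ∀ v ∈ Q.1.support, v = s (padIndex hj i)) := by
      intro i
      by_cases h : (i : ℕ) < j
      · rw [if_pos h]
        exact ⟨P _, fun _ hv => hv, fun _ hv => ⟨h, hv⟩, fun h' => absurd h h'⟩
      · rw [if_neg h]
        refine ⟨⟨.nil, .nil⟩, fun v hv => ?_, fun v hv => ?_, fun _ v hv => by simpa using hv⟩
        · obtain rfl : v = _ := by simpa using hv
          exact (P _).1.start_mem_support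
        · exact absurd (by simpa using hv.1) hv.2.1
    choose Q hQ1 hQ2 hQ3 using key
    have main : ∀ i i' : Fin k, i ≠ i' → ∀ v ∈ (Q i).1.support, ¬ IsInternal (Q i') v := by
      intro i i' hne v hv hv'
      obtain ⟨hi', hint⟩ := hQ2 i' v hv'
      by_cases hc : padIndex hj i = padIndex hj i'
      · by_cases hi : (i : ℕ) < j
        · simp only [padIndex, hi, hi', dif_pos, Fin.mk.injEq] at hc
          exact hne (Fin.ext hc)
        -- A padding path is the single vertex `s 0`, which is an endpoint of the path it duplicates
        -- and so not internal to it.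
        · exact hv'.2.1 ((hQ3 i hi v hv).trans (congrArg s hc))
      · exact (hP _ _ hc).1 v (hQ1 i v hv) hint
    exact ⟨Q, fun i i' hne => ⟨main i i' hne, main i' i hne.symm⟩⟩
  · rintro ⟨Q, hQ⟩
    have hpad : ∀ i : Fin j, padIndex hj (Fin.castLE hjk i : ℕ) = i := fun i => by
      simp [padIndex]
    have hend : ∀ i : Fin j, (fun i : Fin k => if (i : ℕ) < j then t (padIndex hj i) else
        s (padIndex hj i)) (Fin.castLE hjk i) = t i := fun i => by simp [padIndex]
    have key : ∀ i : Fin j, ∃ P : G.Path (s i) (t i),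
        P.1.support = (Q (Fin.castLE hjk i)).1.support := fun i =>
      exists_path_support_eq (congrArg s (hpad i)) (hend i) _
    choose P hP using key
    have hint : ∀ i v, IsInternal (P i) v → IsInternal (Q (Fin.castLE hjk i)) v := by
      rintro i v ⟨h1, h2, h3⟩
      refine ⟨hP i ▸ h1, ?_, by rwa [hend]⟩
      change v ≠ s _
      rwa [hpad]
    refine ⟨P, fun i i' hne => ?_⟩
    have h := hQ (Fin.castLE hjk i) (Fin.castLE hjk i') fun e => hne (Fin.castLE_injective hjk e)
    refine ⟨fun v hv hv' => h.1 v (hP i ▸ hv) (hint _ _ hv'), fun v hv hv' =>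
      h.2 v (hP i' ▸ hv) (hint _ _ hv')⟩

end Padding

/-! ### Translating `FO+DP` formulas into first-order formulas -/

section Collapse

/-- The language map sending the edge symbol to `E`. -/
def graphHom {S : FirstOrder.Language.{v, v'}} (E : S.Relations 2) : Language.graph →ᴸ S where
  onFunction := fun {_} f => f.elim
  onRelation := fun {_} R => match R with
    | .adj => E

theorem realize_onFormula_graphHom {S : FirstOrder.Language.{v, v'}} (E : S.Relations 2) {V : Type u}
    [S.Structure V] {G : SimpleGraph V} (hE : ∀ a b : V, Structure.RelMap E ![a, b] ↔ G.Adj a b)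
    {α : Type*} (φ : Language.graph.Formula α) (a : α → V) :
    ((graphHom E).onFormula φ).Realize a ↔ GraphRealize G φ a := by
  let _ := G.structure
  have : (graphHom E).IsExpansionOn V := by
    refine ⟨fun f => f.elim, fun {n} R x => ?_⟩
    cases R
    refine propext ?_
    have hx : x = ![x 0, x 1] := by
      ext i
      fin_cases i <;> rfl
    rw [hx]
    exact hE _ _
  exact LHom.realize_onFormula _ _

theorem exists_eq_var {S : FirstOrder.Language.{v, v'}} [S.IsRelational] {α : Type*}
    (t : (S.sum dpLang).Term α) : ∃ i, t = Term.var i := by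
  cases t with
  | var i => exact ⟨i, rfl⟩
  | func f ts =>
    rcases f with f | f
    · exact isEmptyElim f
    · exact f.elim

/-- Replacing every disjoint-paths atom by an equivalent first-order formula. -/
theorem exists_boundedFormula_iff {S : FirstOrder.Language.{v, v'}} [S.IsRelational] (E : S.Relations 2)
    {α : Type w} (k L : ℕ) {n : ℕ} (ψ : (S.sum dpLang).BoundedFormula α n) (hψ : DPIndexLE k ψ) :
    ∃ χ : S.BoundedFormula α n, ∀ (V : Type u) [S.Structure V] (G : SimpleGraph V),
      (∀ a b : V, Structure.RelMap E ![a, b] ↔ G.Adj a b) →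
      (∀ x y : Fin k → V, DP G x y ↔ GraphRealize G (dpFormula k L) (Sum.elim x y)) →
      ∀ (a : α → V) (xs : Fin n → V),
        (letI := dpStructure G; ψ.Realize a xs) ↔ χ.Realize a xs := by
  induction ψ with
  | falsum => exact ⟨.falsum, fun V _ G _ _ a xs => Iff.rfl⟩
  | equal t₁ t₂ =>
    obtain ⟨i, rfl⟩ := exists_eq_var t₁
    obtain ⟨j, rfl⟩ := exists_eq_var t₂
    exact ⟨.equal (.var i) (.var j), fun V _ G _ _ a xs => Iff.rfl⟩
  | @rel n l R ts =>
    choose i hi using fun l => exists_eq_var (ts l)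
    obtain rfl : ts = fun l => Term.var (i l) := funext hi
    rcases R with R | R
    · exact ⟨.rel R fun l => .var (i l), fun V _ G _ _ a xs => Iff.rfl⟩
    · cases R with
      | dp j hj =>
        have hjk : j ≤ k := hψ
        -- Padding positions use the first argument of pair `0` for both ends, which encodes the
        -- trivial path.
        refine ⟨BoundedFormula.relabel (n := n) (Sum.elim
            (fun l : Fin k => i (finProdFinEquiv (padIndex hj l, 0)))
            (fun l : Fin k => i (finProdFinEquiv (padIndex hj l, if (l : ℕ) < j then 1 else 0))))
          ((graphHom E).onFormula (dpFormula k L)), fun V _ G hE hDP a xs => ?_⟩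
        have h1 : (letI := dpStructure G; BoundedFormula.Realize (L := S.sum dpLang)
            (.rel (Sum.inr (.dp j hj)) fun l => Term.var (i l)) a xs) ↔
            DP G (fun l => Sum.elim a xs (i (finProdFinEquiv (l, 0))))
              (fun l => Sum.elim a xs (i (finProdFinEquiv (l, 1)))) := Iff.rfl
        rw [h1, dp_pad_iff hj hjk, hDP, BoundedFormula.realize_relabel,
          ← realize_onFormula_graphHom E hE, Formula.Realize]
        have hv : (Sum.elim (fun l : Fin k => Sum.elim a xs (i (finProdFinEquiv (padIndex hj l, 0))))
            (fun l : Fin k => if (l : ℕ) < j then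
              Sum.elim a xs (i (finProdFinEquiv (padIndex hj l, 1))) else
              Sum.elim a xs (i (finProdFinEquiv (padIndex hj l, 0))))) =
            Sum.elim a (xs ∘ Fin.castAdd 0) ∘ Sum.elim
              (fun l : Fin k => i (finProdFinEquiv (padIndex hj l, 0)))
              (fun l : Fin k =>
                i (finProdFinEquiv (padIndex hj l, if (l : ℕ) < j then 1 else 0))) := by
          funext l
          rcases l with l | l
          · rfl
          · by_cases h : (l : ℕ) < j <;> simp [h]
        rw [hv]
        exact iff_of_eq (congrArg _ (Subsingleton.elim _ _))
  | imp φ₁ φ₂ ih₁ ih₂ =>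
    obtain ⟨χ₁, h₁⟩ := ih₁ hψ.1
    obtain ⟨χ₂, h₂⟩ := ih₂ hψ.2
    exact ⟨χ₁.imp χ₂, fun V _ G hE hDP a xs =>
      imp_congr (h₁ V G hE hDP a xs) (h₂ V G hE hDP a xs)⟩
  | all φ ih =>
    obtain ⟨χ, h⟩ := ih hψ
    exact ⟨χ.all, fun V _ G hE hDP a xs => forall_congr' fun v => h V G hE hDP a _⟩

end Collapse

end DPLogic

theorem mainTheorem2 (q : ℕ → ℕ) (k p L t : ℕ) (hp : p = 4 * k ^ 3) (hL : L = q p)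
    (ht : t = max (6 * k ^ 3) (2 * k * L)) :
    (∀ (V : Type u) [Finite V] (G : SimpleGraph V),
      DPLogic.IsUnbreakable G L p →
      DPLogic.IsMinor (⊤ : SimpleGraph (Fin t)) G →
      ∀ x y : Fin k → V,
        DPLogic.DP G x y ↔
          DPLogic.GraphRealize G (DPLogic.dpFormula k L) (Sum.elim x y)) ∧
    (∀ (S : FirstOrder.Language.{v, v'}) [S.IsRelational] (E : S.Relations 2) (α : Type w)
      (ψ : DPLogic.FODPFormula S α), DPLogic.DPIndexLE k ψ →
      ∃ χ : S.Formula α,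
        ∀ (V : Type u) [Finite V] [S.Structure V] (G : SimpleGraph V),
          (∀ u v : V, FirstOrder.Language.Structure.RelMap E ![u, v] ↔ G.Adj u v) →
          DPLogic.IsUnbreakable G L p →
          DPLogic.IsMinor (⊤ : SimpleGraph (Fin t)) G →
          ∀ a : α → V, DPLogic.FODPRealize G ψ a ↔ χ.Realize a) := by
  refine ⟨fun V _ G hG hminor x y => DPLogic.dp_iff_graphRealize hp ht hG hminor x y,
    fun S _ E α ψ hψ => ?_⟩
  obtain ⟨χ, hχ⟩ := DPLogic.exists_boundedFormula_iff E k L ψ hψ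
  exact ⟨χ, fun V _ _ G hE hG hminor a =>
    hχ V G hE (fun x y => DPLogic.dp_iff_graphRealize hp ht hG hminor x y) a _⟩
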